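/- **Setting.** Products $1,\dots,m$ have costs $c\in\mathbb R^m$ and prices $x\in\mathbb R^m$, and are partitioned into non-empty sets $\mathcal V_1,\dots,\mathcal V_N$. A GEV generating function is a function $G$ of $Y\in(0,\infty)^k$ that is twice continuously differentiable, nonnegative, homogeneous of degree one, tends to $\infty$ when one coordinate does (the others being fixed), has positive first partial derivatives, and whose mixed partial derivatives in distinct indices exist and are $\ge 0$ for odd order and $\le 0$ for even (positive) order. Let $G$ be a GEV generating function with $G(Y)=\sum_{n=1}^N G^n(Y^n)$, where each $G^n$ is a GEV generating function of the sub-vector $Y^n=(Y_i)_{i\in\mathcal V_n}$. For parameters $(a,b)\in\mathbb R^m\times\mathbb R^m$ let $Y_i=e^{a_i-b_ix_i}$ and $$\Phi(x,a,b)=\sum_{i=1}^m (x_i-c_i)\frac{Y_i\,\partial_iG(Y)}{1+G(Y)} .$$ Let $\mathcal A=\prod_n\mathcal A^n$, where each $\mathcal A^n$ is a non-empty, convex, compact set of sub-vectors $(a^n,b^n)$; assume that for every $(a,b)\in\mathcal A$ all $b_i>0$ and $b_i=b_j$ whenever $i,j$ lie in the same $\mathcal V_n$. For $t\in\mathbb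 R$ write $G^n(t,a^n,b^n)=G^n\big((e^{a_i-b_i(t+c_i)})_{i\in\mathcal V_n}\big)$ and $\underline{\mathcal G}^n(t)=\min_{\mathcal A^n}G^n(t,\cdot)$, and for $z\in\mathbb R^N$ $$\rho(z,a,b)=\frac{\sum_n z_nG^n(z_n,a^n,b^n)}{1+\sum_nG^n(z_n,a^n,b^n)},\qquad \mathcal W(z)=\frac{\sum_n z_n\underline{\mathcal G}^n(z_n)}{1+\sum_n\underline{\mathcal G}^n(z_n)},\qquad p(z)_n=\frac{\underline{\mathcal G}^n(z_n)}{1+\sum_l\underline{\mathcal G}^l(z_l)} .$$ **Theorem.** All minima over $\mathcal A$ and $\mathcal A^n$ above and below are attained, and there is $z^*\in\mathbb R^N$ such that: 1. The robust problem $\max_{x\in\mathbb R^m}\min_{(a,b)\in\mathcal A}\Phi(x,a,b)$ has exactly one optimal solution $x^*$, namely $x^*_i=z^*_n+c_i$ for $i\in\mathcal V_n$, $n=1,\dots,N$. 2. $z^*$ is the unique optimal solution of $\max_{z\in\mathbb R^N}\min_{(a,b)\in\mathcal A}\rho(z,a,b)$, and the unique optimal solution of $\max_{z\in\mathbb R^N}\mathcal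 W(z)$. 3. The latter problem is a convex program: $z\mapsto p(z)$ is a bijection of $\mathbb R^N$ onto the convex set $\mathcal P=\{p\in\mathbb R^N: p_n>0\ \forall n,\ \sum_np_n<1\}$; with its inverse $p\mapsto z(p)$, the function $p\mapsto\mathcal W(z(p))$ is strictly concave on $\mathcal P$ and its unique maximizer over $\mathcal P$ is $p(z^*)$. For all $n$ and $t$, $G^n(t,\cdot)$ is convex on $\mathcal A^n$, and $\underline{\mathcal G}^n$ is continuous and strictly decreasing. 4. There is $(a^*,b^*)\in\mathcal A$ such that $(a^{n*},b^{n*})$ minimizes $G^n(z^*_n,\cdot)$ over $\mathcal A^n$ for every $n$, and $(x^*,a^*,b^*)$ is a saddle point: $\Phi(x,a^*,b^*)\le\Phi(x^*,a^*,b^*)\le\Phi(x^*,a,b)$ for all $x\in\mathbb R^m$, $(a,b)\in\mathcal A$. (In particular, if these minimizers are unique, they form the saddle point with $x^*$.) 5. $\max_{x\in\mathbb R^m}\min_{(a,b)\in\mathcal A}\Phi(x,a,b)=\min_{(a,b)\in\mathcal A}\max_{x\in\mathbb R^m}\Phi(x,a,b)$, where all maxima and minima are attained. -/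

import Mathlib

namespace RobustPricing

noncomputable section

/-! ### Generalized extreme value (GEV) generating functions -/

/-- The open positive orthant of `ℝ^ι`. -/
def posOrthant (ι : Type*) : Set (ι → ℝ) := {Y | ∀ i, 0 < Y i}

/-- The partial derivative of `F` with respect to the `i`-th coordinate. -/
def partialDeriv {ι : Type*} [DecidableEq ι] (i : ι) (F : (ι → ℝ) → ℝ) : (ι → ℝ) → ℝ :=
  fun Y => lineDeriv ℝ F Y (Pi.single i 1)

/-- The iterated partial derivative `∂_{i₁} (∂_{i₂} (… (∂_{iₖ} F)))` along a list of indices. -/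
def mixedPartial {ι : Type*} [DecidableEq ι] : List ι → ((ι → ℝ) → ℝ) → ((ι → ℝ) → ℝ)
  | [], F => F
  | i :: l, F => partialDeriv i (mixedPartial l F)

/-- `G` is a GEV choice probability generating function (in the arguments `Y_i = exp u_i > 0`). -/
structure IsGEV {ι : Type*} [Fintype ι] [DecidableEq ι] (G : (ι → ℝ) → ℝ) : Prop where
  /-- `G` is twice continuously differentiable. -/
  contDiffOn : ContDiffOn ℝ 2 G (posOrthant ι)
  nonneg : ∀ Y ∈ posOrthant ι, 0 ≤ G Y
  /-- `G` is homogeneous of degree one. -/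
  homogeneous : ∀ Y ∈ posOrthant ι, ∀ t : ℝ, 0 < t → G (t • Y) = t * G Y
  /-- `G` tends to infinity when one coordinate does. -/
  tendsto_atTop : ∀ Y ∈ posOrthant ι, ∀ i : ι,
    Filter.Tendsto (fun t : ℝ => G (Function.update Y i t)) Filter.atTop Filter.atTop
  /-- All mixed partial derivatives in distinct indices exist. -/
  mixed_exists : ∀ (i : ι) (l : List ι), (i :: l).Nodup → ∀ Y ∈ posOrthant ι,
    LineDifferentiableAt ℝ (mixedPartial l G) Y (Pi.single i 1)
  /-- First partial derivatives are positive. -/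
  partial_pos : ∀ i : ι, ∀ Y ∈ posOrthant ι, 0 < partialDeriv i G Y
  /-- Mixed partial derivatives of odd order in distinct indices are nonnegative. -/
  mixed_odd : ∀ l : List ι, l.Nodup → Odd l.length →
    ∀ Y ∈ posOrthant ι, 0 ≤ mixedPartial l G Y
  /-- Mixed partial derivatives of even positive order in distinct indices are nonpositive. -/
  mixed_even : ∀ l : List ι, l.Nodup → l ≠ [] → Even l.length →
    ∀ Y ∈ posOrthant ι, mixedPartial l G Y ≤ 0

/-! ### The pricing model

A pair `ab = (a, b)` collects the choice parameters: utilities are `a i - b i * x i`. -/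

section Model

variable {m N : ℕ}

/-- The GEV choice probability of product `i`: `Y_i ∂_i G(Y) / (1 + G(Y))`. -/
def choiceProb (G : (Fin m → ℝ) → ℝ) (Y : Fin m → ℝ) (i : Fin m) : ℝ :=
  Y i * partialDeriv i G Y / (1 + G Y)

/-- The expected revenue `Φ(x, a, b) = ∑ i, (x_i - c_i) P_i(Y(x, a, b))`, `Y_i = exp(a_i - b_i x_i)`. -/
def revenue (G : (Fin m → ℝ) → ℝ) (c x : Fin m → ℝ) (ab : (Fin m → ℝ) × (Fin m → ℝ)) : ℝ :=
  ∑ i, (x i - c i) * choiceProb G (fun j => Real.exp (ab.1 j - ab.2 j * x j)) i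

/-- The robust objective `min_{(a, b) ∈ A} Φ(x, a, b)`. -/
def robustRevenue (G : (Fin m → ℝ) → ℝ) (c : Fin m → ℝ)
    (A : Set ((Fin m → ℝ) × (Fin m → ℝ))) (x : Fin m → ℝ) : ℝ :=
  sInf (revenue G c x '' A)

/-- The optimal revenue `max_x Φ(x, a, b)` under known parameters. -/
def optimalRevenue (G : (Fin m → ℝ) → ℝ) (c : Fin m → ℝ)
    (ab : (Fin m → ℝ) × (Fin m → ℝ)) : ℝ :=
  sSup (Set.range fun x => revenue G c x ab)

/-! ### Partitions of the products; `part i` is the index of the partition of product `i` -/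

/-- The products of the `n`-th partition. -/
abbrev Block (part : Fin m → Fin N) (n : Fin N) : Type := {i : Fin m // part i = n}

/-- The sub-vector of `v` of the coordinates in the `n`-th partition. -/
def restrict (part : Fin m → Fin N) (n : Fin N) (v : Fin m → ℝ) : Block part n → ℝ :=
  fun i => v i.1

/-- The sub-vectors `(a^n, b^n)` of the choice parameters. -/
def restrictParam (part : Fin m → Fin N) (n : Fin N) (ab : (Fin m → ℝ) × (Fin m → ℝ)) :
    (Block part n → ℝ) × (Block part n → ℝ) :=
  (restrict part n ab.1, restrict part n ab.2)

/-- The prices with constant markup `z n` over the costs in every partition `n`. -/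
def markupPrice (part : Fin m → Fin N) (c : Fin m → ℝ) (z : Fin N → ℝ) : Fin m → ℝ :=
  fun i => z (part i) + c i

variable {part : Fin m → Fin N}

/-- `G^n(Y^n | t, a^n, b^n)`: the `n`-th generating function at the markup `t`. -/
def blockG (Gn : ∀ n, (Block part n → ℝ) → ℝ) (c : Fin m → ℝ) (n : Fin N) (t : ℝ)
    (ab : (Block part n → ℝ) × (Block part n → ℝ)) : ℝ :=
  Gn n (fun i => Real.exp (ab.1 i - ab.2 i * (t + c i.1)))

/-- The expected revenue `ρ(z, a, b)` under the partition-wise markups `z`. -/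
def markupRevenue (Gn : ∀ n, (Block part n → ℝ) → ℝ) (c : Fin m → ℝ) (z : Fin N → ℝ)
    (ab : (Fin m → ℝ) × (Fin m → ℝ)) : ℝ :=
  (∑ n, z n * blockG Gn c n (z n) (restrictParam part n ab)) /
    (1 + ∑ n, blockG Gn c n (z n) (restrictParam part n ab))

/-- `min_{(a, b) ∈ A} ρ(z, a, b)`. -/
def robustMarkupRevenue (Gn : ∀ n, (Block part n → ℝ) → ℝ) (c : Fin m → ℝ)
    (A : Set ((Fin m → ℝ) × (Fin m → ℝ))) (z : Fin N → ℝ) : ℝ :=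
  sInf (markupRevenue Gn c z '' A)

/-- The least value of `G^n(Y^n | t, a^n, b^n)` over `(a^n, b^n) ∈ A^n`. -/
def minBlockG (Gn : ∀ n, (Block part n → ℝ) → ℝ) (c : Fin m → ℝ)
    (An : ∀ n, Set ((Block part n → ℝ) × (Block part n → ℝ))) (n : Fin N) (t : ℝ) : ℝ :=
  sInf (blockG Gn c n t '' An n)

/-- The objective `W(z)` of the reduced problem. -/
def reducedRevenue (Gn : ∀ n, (Block part n → ℝ) → ℝ) (c : Fin m → ℝ)
    (An : ∀ n, Set ((Block part n → ℝ) × (Block part n → ℝ))) (z : Fin N → ℝ) : ℝ :=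
  (∑ n, z n * minBlockG Gn c An n (z n)) / (1 + ∑ n, minBlockG Gn c An n (z n))

/-- The aggregated purchase probabilities `p(z)` of the partitions in the reduced problem. -/
def purchaseProb (Gn : ∀ n, (Block part n → ℝ) → ℝ) (c : Fin m → ℝ)
    (An : ∀ n, Set ((Block part n → ℝ) × (Block part n → ℝ))) (z : Fin N → ℝ) : Fin N → ℝ :=
  fun n => minBlockG Gn c An n (z n) / (1 + ∑ l, minBlockG Gn c An l (z l))

/-- The set of purchase probability vectors: positive entries with sum less than one. -/
def probSet (N : ℕ) : Set (Fin N → ℝ) := {p | (∀ n, 0 < p n) ∧ ∑ n, p n < 1}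

/-- The objective `W(z(p))` of the reduced problem in terms of the purchase probabilities, where
`z(p)` is the inverse of `z ↦ p(z)`. -/
def reducedRevenueOfProb (Gn : ∀ n, (Block part n → ℝ) → ℝ) (c : Fin m → ℝ)
    (An : ∀ n, Set ((Block part n → ℝ) × (Block part n → ℝ))) (p : Fin N → ℝ) : ℝ :=
  reducedRevenue Gn c An (Function.invFun (purchaseProb Gn c An) p)

end Model

end

end RobustPricing

open RobustPricing

/-!
Write `f w = G (exp w)` for a generating function in terms of the utilities `w`. By homogeneity its
Hessian is `diag (∂ f)` plus a symmetric matrix with vanishing row sums, whose off-diagonal entries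
are mixed partial derivatives of `G` and hence nonpositive. So `f` is strictly convex, and satisfies
the strict gradient inequality (`IsGEV.utilGen_gradient_lt`). Since `f (w + s) = exp s * f w`, even
`log ∘ f` is convex (`IsGEV.convexOn_log_utilGen`), and a block with common price sensitivity `β`
has at the markup `t` the demand `exp (k - β * t)`, where `k` is convex in the parameters.

*Known parameters.* The revenue is a ratio, so it is at most `lam` iff the profits over `lam` of all
blocks, `∑ i, (x i - c i - lam) * Y i * ∂_i G`, add up to at most `lam`. The gradient inequality
between the utilities at `x` and at the constant markup `lam + 1 / β` says precisely that the profit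
of a block is at most `peak k β lam = exp (k - β * lam - 1) / β`, with equality only at that markup
(`IsGEV.sum_sub_mul_utilGrad_lt`). Thus the optimal value is the `lam` with `∑ peak = lam`.

*Saddle point.* Let every block minimize `peak` over its parameters and choose `lam` such that the
minimal peaks add up to `lam`, by the intermediate value theorem (`exists_sum_peak_eq`). As
`log peak = k - β * lam - 1 - log β` is convex, the first-order condition at a minimizer says that
it also minimizes the convex function `k - β * t`, hence the demand, at its own optimal markup
`t = lam + 1 / β` (`sub_mul_le_of_isMinOn_peak`). This gives both inequalities of a saddle point of
value `lam`; strictness of the first gives uniqueness, and the problem in the markups and the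
minimax equality follow. The reduced problem is bounded block by block (`reducedRevenue_lt`).

*Convexity of the reduced problem.* The markup at which the least demand of a block is `q` equals
`min ((k - log q) / β)` over the parameters (`minBlockG_eq_iff`). With `p₀ = 1 - ∑ n, p n`, the
objective in terms of the purchase probabilities is therefore the sum over the blocks of
`min ((k * p n - p n * log (p n / p₀)) / β)`, which is concave by the log-sum inequality, strictly
because distinct `p` differ in some ratio `p n / p₀`.
-/

namespace RobustPricing

/-! ### Calculus of generating functions -/

section GEV

variable {ι : Type*}

lemma exp_mem_posOrthant (w : ι → ℝ) : (fun i => Real.exp (w i)) ∈ posOrthant ι :=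
  fun _ => Real.exp_pos _

variable [Fintype ι]

lemma isOpen_posOrthant : IsOpen (posOrthant ι) := by
  have h : posOrthant ι = Set.univ.pi fun _ => Set.Ioi (0 : ℝ) := by
    ext Y; simp [posOrthant]
  rw [h]
  exact isOpen_set_pi Set.finite_univ fun _ _ => isOpen_Ioi

/-- A symmetric matrix with nonpositive off-diagonal entries and vanishing row sums is positive
semidefinite: its quadratic form is `-½ ∑ i j, M i j (v i - v j)²`. -/
lemma quadraticForm_nonneg_of_sum_eq_zero {M : ι → ι → ℝ} (hsymm : ∀ i j, M i j = M j i)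
    (hoff : ∀ i j, i ≠ j → M i j ≤ 0) (hsum : ∀ j, ∑ i, M i j = 0) (v : ι → ℝ) :
    0 ≤ ∑ i, ∑ j, v i * v j * M i j := by
  have h1 : ∑ i, ∑ j, (v i - v j) ^ 2 * M i j ≤ 0 := by
    refine Finset.sum_nonpos fun i _ => Finset.sum_nonpos fun j _ => ?_
    rcases eq_or_ne i j with rfl | hij
    · simp
    · exact mul_nonpos_of_nonneg_of_nonpos (sq_nonneg _) (hoff i j hij)
  have h2 : ∑ i, ∑ j, v j ^ 2 * M i j = 0 := by
    rw [Finset.sum_comm]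
    simp [← Finset.mul_sum, hsum]
  have h3 : ∑ i, ∑ j, v i ^ 2 * M i j = 0 := by
    have hsum' : ∀ i, ∑ j, M i j = 0 := fun i =>
      (Finset.sum_congr rfl fun j _ => hsymm i j).trans (hsum i)
    simp [← Finset.mul_sum, hsum']
  have h4 : ∑ i, ∑ j, (v i - v j) ^ 2 * M i j =
      ∑ i, ∑ j, v i ^ 2 * M i j + ∑ i, ∑ j, v j ^ 2 * M i j
        - 2 * ∑ i, ∑ j, v i * v j * M i j := by
    simp only [Finset.mul_sum, ← Finset.sum_add_distrib, ← Finset.sum_sub_distrib]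
    exact Finset.sum_congr rfl fun i _ => Finset.sum_congr rfl fun j _ => by ring
  linarith

variable [DecidableEq ι] {G : (ι → ℝ) → ℝ}

lemma fderiv_apply_eq_sum_partialDeriv {F : (ι → ℝ) → ℝ} {Y : ι → ℝ}
    (hF : DifferentiableAt ℝ F Y) (v : ι → ℝ) :
    fderiv ℝ F Y v = ∑ j, v j * partialDeriv j F Y := by
  have h := LinearMap.pi_apply_eq_sum_univ (fderiv ℝ F Y).toLinearMap v
  simp only [ContinuousLinearMap.coe_coe, smul_eq_mul] at h
  rw [h]
  refine Finset.sum_congr rfl fun j _ => ?_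
  rw [partialDeriv, hF.lineDeriv_eq_fderiv]
  congr 2
  ext i
  simp [Pi.single_apply, eq_comm]

lemma hasDerivAt_comp_of_differentiableAt {F : (ι → ℝ) → ℝ} {W : ℝ → ι → ℝ} {W' : ι → ℝ} {s : ℝ}
    (hF : DifferentiableAt ℝ F (W s)) (hW : HasDerivAt W W' s) :
    HasDerivAt (fun s => F (W s)) (∑ j, W' j * partialDeriv j F (W s)) s := by
  rw [← fderiv_apply_eq_sum_partialDeriv hF]
  exact hF.hasFDerivAt.comp_hasDerivAt s hW

namespace IsGEV

variable (hG : IsGEV G)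
include hG

lemma contDiffAt {Y : ι → ℝ} (hY : Y ∈ posOrthant ι) : ContDiffAt ℝ 2 G Y :=
  hG.contDiffOn.contDiffAt (isOpen_posOrthant.mem_nhds hY)

lemma differentiableAt {Y : ι → ℝ} (hY : Y ∈ posOrthant ι) : DifferentiableAt ℝ G Y :=
  (hG.contDiffAt hY).differentiableAt (by norm_num)

lemma partialDeriv_eq_fderiv {Y : ι → ℝ} (hY : Y ∈ posOrthant ι) (i : ι) :
    partialDeriv i G Y = fderiv ℝ G Y (Pi.single i 1) :=
  (hG.differentiableAt hY).lineDeriv_eq_fderiv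

lemma partialDeriv_eventuallyEq {Y : ι → ℝ} (hY : Y ∈ posOrthant ι) (i : ι) :
    partialDeriv i G =ᶠ[nhds Y] fun Y => fderiv ℝ G Y (Pi.single i 1) := by
  filter_upwards [isOpen_posOrthant.mem_nhds hY] with Z hZ using hG.partialDeriv_eq_fderiv hZ i

lemma differentiableAt_fderiv {Y : ι → ℝ} (hY : Y ∈ posOrthant ι) :
    DifferentiableAt ℝ (fderiv ℝ G) Y :=
  ((hG.contDiffAt hY).fderiv_right (m := 1) (by norm_num)).differentiableAt (by norm_num)

lemma differentiableAt_partialDeriv {Y : ι → ℝ} (hY : Y ∈ posOrthant ι) (i : ι) :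
    DifferentiableAt ℝ (partialDeriv i G) Y :=
  ((hG.differentiableAt_fderiv hY).clm_apply (differentiableAt_const _)).congr_of_eventuallyEq
    (hG.partialDeriv_eventuallyEq hY i)

lemma partialDeriv_partialDeriv {Y : ι → ℝ} (hY : Y ∈ posOrthant ι) (i j : ι) :
    partialDeriv j (partialDeriv i G) Y =
      fderiv ℝ (fderiv ℝ G) Y (Pi.single j 1) (Pi.single i 1) := by
  have h : partialDeriv j (partialDeriv i G) Y =
      fderiv ℝ (partialDeriv i G) Y (Pi.single j 1) :=
    (hG.differentiableAt_partialDeriv hY i).lineDeriv_eq_fderiv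
  rw [h, (hG.partialDeriv_eventuallyEq hY i).fderiv_eq,
    fderiv_clm_apply (hG.differentiableAt_fderiv hY) (differentiableAt_const _)]
  simp

lemma partialDeriv_comm {Y : ι → ℝ} (hY : Y ∈ posOrthant ι) (i j : ι) :
    partialDeriv j (partialDeriv i G) Y = partialDeriv i (partialDeriv j G) Y := by
  rw [hG.partialDeriv_partialDeriv hY, hG.partialDeriv_partialDeriv hY]
  exact ((hG.contDiffAt hY).isSymmSndFDerivAt (by simp)).eq _ _

lemma partialDeriv_partialDeriv_nonpos {Y : ι → ℝ} (hY : Y ∈ posOrthant ι) {i j : ι}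
    (hij : j ≠ i) : partialDeriv j (partialDeriv i G) Y ≤ 0 :=
  hG.mixed_even [j, i] (by simpa using hij) (by simp) (by simp) Y hY

/-- Euler's identity for the homogeneous function `G`. -/
lemma sum_mul_partialDeriv {Y : ι → ℝ} (hY : Y ∈ posOrthant ι) :
    ∑ i, Y i * partialDeriv i G Y = G Y := by
  have hW : HasDerivAt (fun t : ℝ => t • Y) Y 1 := by
    simpa using (hasDerivAt_id (1 : ℝ)).smul_const Y
  have h1 := hasDerivAt_comp_of_differentiableAt (F := G) (W := fun t : ℝ => t • Y)
    (by simpa using hG.differentiableAt hY) hW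
  have h2 : HasDerivAt (fun t : ℝ => t * G Y) (G Y) 1 := by
    simpa using (hasDerivAt_id (1 : ℝ)).mul_const (G Y)
  have he : (fun t : ℝ => G (t • Y)) =ᶠ[nhds 1] fun t => t * G Y := by
    filter_upwards [lt_mem_nhds zero_lt_one] with t ht using hG.homogeneous Y hY t ht
  simpa using h1.unique (h2.congr_of_eventuallyEq he)

/-- First partial derivatives are homogeneous of degree zero; this is Euler's identity for them,
obtained by differentiating the one for `G`. -/
lemma sum_mul_partialDeriv_partialDeriv {Y : ι → ℝ} (hY : Y ∈ posOrthant ι) (j : ι) :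
    ∑ i, Y i * partialDeriv j (partialDeriv i G) Y = 0 := by
  have he : (fun Y => ∑ i, Y i * partialDeriv i G Y) =ᶠ[nhds Y] G := by
    filter_upwards [isOpen_posOrthant.mem_nhds hY] with Z hZ using hG.sum_mul_partialDeriv hZ
  have h1 : HasFDerivAt (fun Y : ι → ℝ => ∑ i, Y i * partialDeriv i G Y)
      (∑ i, (Y i • fderiv ℝ (partialDeriv i G) Y +
        partialDeriv i G Y • ContinuousLinearMap.proj (R := ℝ) (φ := fun _ : ι => ℝ) i)) Y :=
    HasFDerivAt.fun_sum fun i _ => (hasFDerivAt_apply i Y).mul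
      (hG.differentiableAt_partialDeriv hY i).hasFDerivAt
  have h2 := congrArg (fun L => L (Pi.single j (1 : ℝ)))
    (h1.unique ((hG.differentiableAt hY).hasFDerivAt.congr_of_eventuallyEq he))
  simp only [sum_apply, add_apply, smul_apply, ContinuousLinearMap.proj_apply, smul_eq_mul,
    Finset.sum_add_distrib, ← hG.partialDeriv_eq_fderiv hY] at h2
  have h3 : ∑ i, partialDeriv i G Y * (Pi.single j (1 : ℝ) : ι → ℝ) i = partialDeriv j G Y := by
    simp [Pi.single_apply]
  rw [h3] at h2
  have h4 : ∀ i, fderiv ℝ (partialDeriv i G) Y (Pi.single j 1) =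
      partialDeriv j (partialDeriv i G) Y := fun i =>
    ((hG.differentiableAt_partialDeriv hY i).lineDeriv_eq_fderiv).symm
  simp only [h4] at h2
  linarith

end IsGEV

/-- The generating function in terms of the utilities `w i = log (Y i)`. -/
noncomputable def utilGen (G : (ι → ℝ) → ℝ) (w : ι → ℝ) : ℝ := G fun i => Real.exp (w i)

/-- The partial derivatives of `utilGen G`. -/
noncomputable def utilGrad (G : (ι → ℝ) → ℝ) (w : ι → ℝ) (i : ι) : ℝ :=
  Real.exp (w i) * partialDeriv i G fun j => Real.exp (w j)

namespace IsGEV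

variable (hG : IsGEV G)
include hG

lemma utilGrad_pos (w : ι → ℝ) (i : ι) : 0 < utilGrad G w i :=
  mul_pos (Real.exp_pos _) (hG.partial_pos i _ (exp_mem_posOrthant w))

lemma sum_utilGrad (w : ι → ℝ) : ∑ i, utilGrad G w i = utilGen G w :=
  hG.sum_mul_partialDeriv (exp_mem_posOrthant w)

lemma utilGen_nonneg (w : ι → ℝ) : 0 ≤ utilGen G w := hG.nonneg _ (exp_mem_posOrthant w)

lemma utilGen_pos [Nonempty ι] (w : ι → ℝ) : 0 < utilGen G w := by
  rw [← hG.sum_utilGrad]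
  exact Finset.sum_pos (fun i _ => hG.utilGrad_pos w i) Finset.univ_nonempty

lemma utilGen_add_const (w : ι → ℝ) (s : ℝ) :
    utilGen G (fun i => w i + s) = Real.exp s * utilGen G w := by
  rw [utilGen, utilGen, ← hG.homogeneous _ (exp_mem_posOrthant w) _ (Real.exp_pos s)]
  congr 1
  ext i
  simp [Real.exp_add, mul_comm]

lemma continuous_utilGen : Continuous (utilGen G) :=
  hG.contDiffOn.continuousOn.comp_continuous (by fun_prop) exp_mem_posOrthant

lemma continuous_utilGrad (i : ι) : Continuous fun w => utilGrad G w i := by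
  have h : ContinuousOn (partialDeriv i G) (posOrthant ι) := fun Y hY =>
    (hG.differentiableAt_partialDeriv hY i).continuousAt.continuousWithinAt
  exact (by fun_prop : Continuous fun w : ι → ℝ => Real.exp (w i)).mul
    (h.comp_continuous (by fun_prop) exp_mem_posOrthant)

lemma hasDerivAt_utilGen_line (w v : ι → ℝ) (s : ℝ) :
    HasDerivAt (fun s => utilGen G fun i => w i + s * v i)
      (∑ i, v i * utilGrad G (fun i => w i + s * v i) i) s := by
  have hW : HasDerivAt (fun (s : ℝ) (i : ι) => Real.exp (w i + s * v i))
      (fun i => Real.exp (w i + s * v i) * v i) s := by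
    refine hasDerivAt_pi.2 fun i => ?_
    simpa using ((((hasDerivAt_id s).mul_const (v i)).const_add (w i)).exp)
  have h := hasDerivAt_comp_of_differentiableAt
    (hG.differentiableAt (exp_mem_posOrthant fun i => w i + s * v i)) hW
  refine h.congr_deriv (Finset.sum_congr rfl fun i _ => ?_)
  simp only [utilGrad]
  ring

/-- Along a line, the second derivative of `utilGen G` exceeds `∑ i, (v i)² utilGrad G w i`, since
the remaining part of the Hessian is a symmetric matrix with nonpositive off-diagonal entries and
vanishing row sums. -/
lemma exists_hasDerivAt_utilGrad_line (w : ι → ℝ) {v : ι → ℝ} (hv : v ≠ 0) (s : ℝ) :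
    ∃ d, 0 < d ∧
      HasDerivAt (fun s => ∑ i, v i * utilGrad G (fun i => w i + s * v i) i) d s := by
  set Y : ι → ℝ := fun i => Real.exp (w i + s * v i) with hYdef
  have hY : Y ∈ posOrthant ι := exp_mem_posOrthant fun i => w i + s * v i
  have hWi : ∀ i, HasDerivAt (fun s : ℝ => Real.exp (w i + s * v i)) (Y i * v i) s := fun i => by
    simpa using ((((hasDerivAt_id s).mul_const (v i)).const_add (w i)).exp)
  have hW : HasDerivAt (fun (s : ℝ) (i : ι) => Real.exp (w i + s * v i))
      (fun i => Y i * v i) s := hasDerivAt_pi.2 hWi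
  have hD : ∀ i, HasDerivAt (fun s : ℝ => partialDeriv i G fun i => Real.exp (w i + s * v i))
      (∑ j, (Y j * v j) * partialDeriv j (partialDeriv i G) Y) s := fun i =>
    hasDerivAt_comp_of_differentiableAt (hG.differentiableAt_partialDeriv hY i) hW
  have hder := HasDerivAt.fun_sum (u := Finset.univ) fun i _ =>
    ((hWi i).mul (hD i)).const_mul (v i)
  refine ⟨_, ?_, hder⟩
  have hquad := quadraticForm_nonneg_of_sum_eq_zero
    (M := fun i j => Y i * Y j * partialDeriv j (partialDeriv i G) Y)
    (fun i j => by simp only [hG.partialDeriv_comm hY i j]; ring)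
    (fun i j hij => mul_nonpos_of_nonneg_of_nonpos (mul_pos (hY i) (hY j)).le
      (hG.partialDeriv_partialDeriv_nonpos hY hij.symm))
    (fun j => by
      have := hG.sum_mul_partialDeriv_partialDeriv hY j
      calc ∑ i, Y i * Y j * partialDeriv j (partialDeriv i G) Y
          = Y j * ∑ i, Y i * partialDeriv j (partialDeriv i G) Y := by
            rw [Finset.mul_sum]; exact Finset.sum_congr rfl fun i _ => by ring
        _ = 0 := by rw [this, mul_zero]) v
  have hdiag : 0 < ∑ i, v i ^ 2 * (Y i * partialDeriv i G Y) := by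
    obtain ⟨i, hi⟩ := Function.ne_iff.1 hv
    refine Finset.sum_pos' (fun i _ => mul_nonneg (sq_nonneg _)
      (mul_pos (hY i) (hG.partial_pos i Y hY)).le) ⟨i, Finset.mem_univ i, ?_⟩
    exact mul_pos (sq_pos_of_ne_zero hi) (mul_pos (hY i) (hG.partial_pos i Y hY))
  refine (add_pos_of_pos_of_nonneg hdiag hquad).trans_eq ?_
  rw [← Finset.sum_add_distrib]
  refine Finset.sum_congr rfl fun i _ => ?_
  rw [mul_add, Finset.mul_sum, Finset.mul_sum]
  congr 1
  · simp only [← hYdef]; ring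
  · exact Finset.sum_congr rfl fun j _ => by ring

/-- The strict gradient inequality for the strictly convex function `utilGen G`. -/
lemma utilGen_gradient_lt {w w' : ι → ℝ} (h : w' ≠ w) :
    utilGen G w + ∑ i, (w' i - w i) * utilGrad G w i < utilGen G w' := by
  have hv : w' - w ≠ 0 := sub_ne_zero.2 h
  set g : ℝ → ℝ := fun s => utilGen G fun i => w i + s * (w' - w) i with hg
  have hg' : deriv g = fun s => ∑ i, (w' - w) i * utilGrad G (fun i => w i + s * (w' - w) i) i :=
    funext fun s => (hG.hasDerivAt_utilGen_line w (w' - w) s).deriv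
  have hconv : StrictConvexOn ℝ Set.univ g := by
    refine strictConvexOn_univ_of_deriv2_pos (hG.continuous_utilGen.comp (by fun_prop)) fun s => ?_
    obtain ⟨d, hd, hds⟩ := hG.exists_hasDerivAt_utilGrad_line w hv s
    rw [Function.iterate_succ, Function.iterate_one, Function.comp_apply, hg', hds.deriv]
    exact hd
  have := hconv.lt_slope_of_hasDerivAt (Set.mem_univ 0) (Set.mem_univ 1) zero_lt_one
    (hG.hasDerivAt_utilGen_line w (w' - w) 0)
  simp [slope_def_field, hg] at this
  linarith

lemma utilGen_gradient_le (w w' : ι → ℝ) :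
    utilGen G w + ∑ i, (w' i - w i) * utilGrad G w i ≤ utilGen G w' := by
  rcases eq_or_ne w' w with rfl | h
  · simp
  · exact (hG.utilGen_gradient_lt h).le

lemma convexOn_utilGen : ConvexOn ℝ Set.univ (utilGen G) := by
  refine ⟨convex_univ, fun x _ y _ s t hs ht hst => ?_⟩
  set w := s • x + t • y with hw
  have hx := mul_le_mul_of_nonneg_left (hG.utilGen_gradient_le w x) hs
  have hy := mul_le_mul_of_nonneg_left (hG.utilGen_gradient_le w y) ht
  have h0 : s * ∑ i, (x i - w i) * utilGrad G w i + t * ∑ i, (y i - w i) * utilGrad G w i = 0 := by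
    rw [Finset.mul_sum, Finset.mul_sum, ← Finset.sum_add_distrib]
    refine Finset.sum_eq_zero fun i _ => ?_
    have : w i = s * x i + t * y i := rfl
    obtain rfl : s = 1 - t := by linarith
    rw [this]; ring
  have h1 : utilGen G w = s * utilGen G w + t * utilGen G w := by rw [← add_mul, hst, one_mul]
  simp only [smul_eq_mul]
  linarith

/-- `log ∘ utilGen G` is convex (like the log-sum-exp function): a convex function `f` with
`f (w + s) = exp s * f w` satisfies `f (w - log (f w)) = 1`, and `{f ≤ 1}` is convex. -/
lemma convexOn_log_utilGen [Nonempty ι] :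
    ConvexOn ℝ Set.univ fun w => Real.log (utilGen G w) := by
  refine ⟨convex_univ, fun x _ y _ s t hs ht hst => ?_⟩
  have hone : ∀ w, utilGen G (fun i => w i + -Real.log (utilGen G w)) = 1 := fun w => by
    rw [hG.utilGen_add_const, Real.exp_neg, Real.exp_log (hG.utilGen_pos w),
      inv_mul_cancel₀ (hG.utilGen_pos w).ne']
  have h := hG.convexOn_utilGen.2 (Set.mem_univ fun i => x i + -Real.log (utilGen G x))
    (Set.mem_univ fun i => y i + -Real.log (utilGen G y)) hs ht hst
  rw [hone, hone, smul_eq_mul, smul_eq_mul, mul_one, mul_one, hst] at h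
  have he : (s • (fun i => x i + -Real.log (utilGen G x)) +
      t • fun i => y i + -Real.log (utilGen G y)) = fun i => (s • x + t • y) i +
        -(s * Real.log (utilGen G x) + t * Real.log (utilGen G y)) := by
    ext i
    simp only [Pi.add_apply, Pi.smul_apply, smul_eq_mul]
    ring
  rw [he, hG.utilGen_add_const, Real.exp_neg, inv_mul_le_iff₀ (Real.exp_pos _), mul_one] at h
  simpa using (Real.log_le_iff_le_exp (hG.utilGen_pos _)).2 h

end IsGEV

end GEV

/-! ### Markup optimization for exponential demand -/

/-- The maximum over the markups `t` of `(t - lam) * exp (k - β * t)`, attained at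
`t = lam + 1 / β`. -/
noncomputable def peak (k β lam : ℝ) : ℝ := Real.exp (k - β * lam - 1) / β

lemma peak_pos {k β lam : ℝ} (hβ : 0 < β) : 0 < peak k β lam := div_pos (Real.exp_pos _) hβ

lemma peak_antitone {k β : ℝ} (hβ : 0 < β) : Antitone (peak k β) := fun s t hst => by
  unfold peak
  gcongr

lemma log_peak {k β lam : ℝ} (hβ : 0 < β) :
    Real.log (peak k β lam) = k - β * lam - 1 - Real.log β := by
  rw [peak, Real.log_div (Real.exp_pos _).ne' hβ.ne', Real.log_exp]

lemma sub_mul_exp_eq_peak {k β lam : ℝ} (hβ : 0 < β) :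
    (lam + 1 / β - lam) * Real.exp (k - β * (lam + 1 / β)) = peak k β lam := by
  have h : k - β * (lam + 1 / β) = k - β * lam - 1 := by field_simp; ring
  rw [h, peak]
  ring

lemma sub_mul_exp_lt_peak {k β lam t : ℝ} (hβ : 0 < β) (ht : t ≠ lam + 1 / β) :
    (t - lam) * Real.exp (k - β * t) < peak k β lam := by
  have hne : β * (t - lam) - 1 ≠ 0 := by
    contrapose! ht
    field_simp
    linarith
  have h := Real.add_one_lt_exp hne
  rw [peak, lt_div_iff₀ hβ]
  have he : Real.exp (k - β * lam - 1) =
      Real.exp (β * (t - lam) - 1) * Real.exp (k - β * t) := by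
    rw [← Real.exp_add]; congr 1; ring
  rw [he]
  calc (t - lam) * Real.exp (k - β * t) * β
      = (β * (t - lam) - 1 + 1) * Real.exp (k - β * t) := by ring
    _ < _ := mul_lt_mul_of_pos_right h (Real.exp_pos _)

/-- First-order optimality condition: if `e` minimizes the peak profit over a convex set, on which
`k` is convex and `β` is linear, then `e` minimizes the demand `exp (k - β * t)` at the markup
`t = lam + 1 / β e` that is optimal for `e`. -/
lemma sub_mul_le_of_isMinOn_peak {E : Type*} [AddCommGroup E] [Module ℝ E] {K : Set E}
    {k : E → ℝ} (hk : ConvexOn ℝ K k) (β : E →ₗ[ℝ] ℝ) (hβ : ∀ e ∈ K, 0 < β e) {lam : ℝ} {e e' : E}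
    (he : e ∈ K) (he' : e' ∈ K) (hmin : IsMinOn (fun e => peak (k e) (β e) lam) K e) :
    k e - β e * (lam + 1 / β e) ≤ k e' - β e' * (lam + 1 / β e) := by
  have hb := hβ e he
  have hb' := hβ e' he'
  -- compare `e` with the points `e + s (e' - e)` and let `s` tend to zero
  have key : ∀ s ∈ Set.Ioo (0 : ℝ) 1,
      (β e' - β e) / ((1 - s) * β e + s * β e') ≤ k e' - k e - (β e' - β e) * lam := by
    rintro s ⟨hs0, hs1⟩
    have hmem : (1 - s) • e + s • e' ∈ K := hk.1 he he' (by linarith) hs0.le (by ring)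
    have hbs : β ((1 - s) • e + s • e') = (1 - s) * β e + s * β e' := by simp
    have hbs_pos := hβ _ hmem
    have h1 := Real.log_le_log (peak_pos hb) (isMinOn_iff.1 hmin _ hmem)
    rw [log_peak hb, log_peak hbs_pos] at h1
    have h2 := hk.2 he he' (by linarith : 0 ≤ 1 - s) hs0.le (by ring)
    simp only [smul_eq_mul] at h2
    rw [hbs] at h1 hbs_pos
    set B := (1 - s) * β e + s * β e' with hB
    have h3 := Real.one_sub_inv_le_log_of_pos (div_pos hbs_pos hb)
    rw [Real.log_div hbs_pos.ne' hb.ne', inv_div] at h3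
    have h4 : 1 - β e / B = s * ((β e' - β e) / B) := by
      field_simp
      rw [hB]; ring
    have h5 : s * ((β e' - β e) / B) ≤ s * (k e' - k e - (β e' - β e) * lam) := by
      have : B * lam = β e * lam + s * ((β e' - β e) * lam) := by rw [hB]; ring
      nlinarith
    exact le_of_mul_le_mul_left h5 hs0
  have hlim : Filter.Tendsto (fun s : ℝ => (β e' - β e) / ((1 - s) * β e + s * β e'))
      (nhdsWithin 0 (Set.Ioi 0)) (nhds ((β e' - β e) / β e)) := by
    have hc : ContinuousAt (fun s : ℝ => (β e' - β e) / ((1 - s) * β e + s * β e')) 0 := by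
      refine ContinuousAt.div (by fun_prop) (by fun_prop) ?_
      simpa using hb.ne'
    simpa using hc.tendsto.mono_left nhdsWithin_le_nhds
  have h := le_of_tendsto hlim (by
    filter_upwards [Ioo_mem_nhdsGT (zero_lt_one' ℝ)] with s hs using key s hs)
  have h6 : (β e' - β e) / β e = β e' * (1 / β e) - β e * (1 / β e) := by ring
  rw [h6] at h
  nlinarith

/-- The worst-case optimal value `lam`: the fixed point of the decreasing function
`lam ↦ ∑ n, min (peak · · lam)`. -/
lemma exists_sum_peak_eq {ν : Type*} [Fintype ν] {E : ν → Type*} [∀ n, TopologicalSpace (E n)]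
    {K : ∀ n, Set (E n)} {k β : ∀ n, E n → ℝ} (hK : ∀ n, IsCompact (K n))
    (hne : ∀ n, (K n).Nonempty) (hk : ∀ n, ContinuousOn (k n) (K n))
    (hβ : ∀ n, ContinuousOn (β n) (K n)) (hpos : ∀ n, ∀ e ∈ K n, 0 < β n e) :
    ∃ (lam : ℝ) (e : ∀ n, E n), (∀ n, e n ∈ K n) ∧
      (∀ n, IsMinOn (fun e => peak (k n e) (β n e) lam) (K n) (e n)) ∧
      ∑ n, peak (k n (e n)) (β n (e n)) lam = lam := by
  have hcont : ∀ n, Continuous fun p : ℝ × K n => peak (k n p.2) (β n p.2) p.1 := fun n => by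
    have h1 := (continuousOn_iff_continuous_domRestrict.1 (hk n)).comp
      (continuous_snd : Continuous (Prod.snd : ℝ × K n → K n))
    have h2 := (continuousOn_iff_continuous_domRestrict.1 (hβ n)).comp
      (continuous_snd : Continuous (Prod.snd : ℝ × K n → K n))
    exact (((h1.sub (h2.mul continuous_fst)).sub continuous_const).rexp).div h2
      fun p => (hpos n _ p.2.2).ne'
  have hmin : ∀ n lam, ∃ e : K n, IsLeast (Set.range fun e : K n => peak (k n e) (β n e) lam)
      (peak (k n e) (β n e) lam) := fun n lam => by
    have := isCompact_iff_compactSpace.1 (hK n)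
    have := (hne n).to_subtype
    obtain ⟨e, -, he⟩ := isCompact_univ.exists_isMinOn Set.univ_nonempty
      ((hcont n).comp (by fun_prop : Continuous fun e : K n => (lam, e))).continuousOn
    exact ⟨e, ⟨e, rfl⟩, by rintro _ ⟨e', rfl⟩; exact isMinOn_iff.1 he e' (Set.mem_univ _)⟩
  choose e he using hmin
  set v : ν → ℝ → ℝ := fun n lam => peak (k n (e n lam)) (β n (e n lam)) lam with hv
  have hvc : ∀ n, Continuous (v n) := fun n => by
    have := isCompact_iff_compactSpace.1 (hK n)
    have h := isCompact_univ.continuous_sInf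
      (f := fun (lam : ℝ) (e : K n) => peak (k n e) (β n e) lam) (hcont n)
    convert h using 2 with lam
    rw [Set.image_univ, (he n lam).csInf_eq]
  have hva : ∀ n, Antitone (v n) := fun n s t hst =>
    ((he n t).2 ⟨e n s, rfl⟩).trans (peak_antitone (hpos n _ (e n s).2) hst)
  have hsum0 : 0 ≤ ∑ n, v n 0 :=
    Finset.sum_nonneg fun n _ => (peak_pos (hpos n _ (e n 0).2)).le
  have hIVT := intermediate_value_Icc hsum0 (f := fun lam => lam - ∑ n, v n lam)
    (continuous_id.sub (continuous_finsetSum _ fun n _ => hvc n)).continuousOn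
  obtain ⟨lam, -, hlam⟩ := hIVT (show (0 : ℝ) ∈ _ from ⟨by simpa using hsum0,
    sub_nonneg.2 (Finset.sum_le_sum fun n _ => hva n hsum0)⟩)
  exact ⟨lam, fun n => e n lam, fun n => (e n lam).2,
    fun n => isMinOn_iff.2 fun x hx => (he n lam).2 ⟨⟨x, hx⟩, rfl⟩, (sub_eq_zero.1 hlam).symm⟩

/-- The log-sum inequality: `(p, q) ↦ p * log (p / q)` is convex, strictly so between points of
different ratios. -/
lemma mul_log_div_lt {p q p' q' s t : ℝ} (hp : 0 < p) (hq : 0 < q) (hp' : 0 < p') (hq' : 0 < q')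
    (hs : 0 < s) (ht : 0 < t) (hne : p / q ≠ p' / q') :
    (s * p + t * p') * Real.log ((s * p + t * p') / (s * q + t * q')) <
      s * (p * Real.log (p / q)) + t * (p' * Real.log (p' / q')) := by
  have hQ : 0 < s * q + t * q' := by positivity
  have h := Real.strictConvexOn_mul_log.2 (Set.mem_Ici.2 (div_pos hp hq).le)
    (Set.mem_Ici.2 (div_pos hp' hq').le) hne
    (div_pos (mul_pos hs hq) hQ) (div_pos (mul_pos ht hq') hQ)
    (by rw [← add_div, div_self hQ.ne'])
  simp only [smul_eq_mul] at h
  have h1 : s * q / (s * q + t * q') * (p / q) + t * q' / (s * q + t * q') * (p' / q') =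
      (s * p + t * p') / (s * q + t * q') := by field_simp
  rw [h1] at h
  have h2 := mul_lt_mul_of_pos_right h hQ
  calc _ = (s * p + t * p') / (s * q + t * q') *
        Real.log ((s * p + t * p') / (s * q + t * q')) * (s * q + t * q') := by field_simp
    _ < _ := h2
    _ = _ := by field_simp

lemma mul_log_div_le {p q p' q' s t : ℝ} (hp : 0 < p) (hq : 0 < q) (hp' : 0 < p') (hq' : 0 < q')
    (hs : 0 < s) (ht : 0 < t) :
    (s * p + t * p') * Real.log ((s * p + t * p') / (s * q + t * q')) ≤
      s * (p * Real.log (p / q)) + t * (p' * Real.log (p' / q')) := by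
  by_cases hne : p / q = p' / q'
  · have h1 : (s * p + t * p') / (s * q + t * q') = p' / q' := by
      rw [div_eq_div_iff hq.ne' hq'.ne'] at hne
      rw [div_eq_div_iff (by positivity) hq'.ne']
      linear_combination s * hne
    rw [h1, hne]
    exact le_of_eq (by ring)
  · exact (mul_log_div_lt hp hq hp' hq' hs ht hne).le

/-- The profits over `lam` of products with a common price sensitivity `β` are uniquely maximized by
the common markup `lam + 1 / β`. This is the gradient inequality of `utilGen G` at the utilities of
the prices `x`, against the utilities at that markup. -/
lemma IsGEV.sum_sub_mul_utilGrad_lt {ι : Type*} [Fintype ι] [DecidableEq ι] {G : (ι → ℝ) → ℝ}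
    (hG : IsGEV G) {β lam : ℝ} (hβ : 0 < β) {b : ι → ℝ}
    (hb : ∀ i, b i = β) (a c : ι → ℝ) {x : ι → ℝ}
    (hx : x ≠ fun i => lam + 1 / β + c i) :
    ∑ i, (x i - c i - lam) * utilGrad G (fun i => a i - b i * x i) i <
      utilGen G (fun i => a i - b i * (lam + 1 / β + c i)) / β := by
  obtain rfl : b = fun _ => β := funext hb
  have hw : (fun i => a i - β * (lam + 1 / β + c i)) ≠ fun i => a i - β * x i := by
    contrapose! hx
    funext i
    have := congrFun hx i
    simp only [sub_right_inj] at this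
    exact (mul_left_cancel₀ hβ.ne' this).symm
  have h := hG.utilGen_gradient_lt hw
  rw [lt_div_iff₀ hβ, Finset.sum_mul]
  refine lt_of_eq_of_lt ?_ h
  rw [← hG.sum_utilGrad, ← Finset.sum_add_distrib]
  refine Finset.sum_congr rfl fun i _ => ?_
  field_simp
  ring

lemma IsGEV.sum_sub_mul_utilGrad_le {ι : Type*} [Fintype ι] [DecidableEq ι] {G : (ι → ℝ) → ℝ}
    (hG : IsGEV G) {β lam : ℝ} (hβ : 0 < β) {b : ι → ℝ}
    (hb : ∀ i, b i = β) (a c x : ι → ℝ) :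
    ∑ i, (x i - c i - lam) * utilGrad G (fun i => a i - b i * x i) i ≤
      utilGen G (fun i => a i - b i * (lam + 1 / β + c i)) / β := by
  by_cases hx : x = fun i => lam + 1 / β + c i
  · refine le_of_eq ?_
    rw [← hG.sum_utilGrad, Finset.sum_div]
    subst hx
    exact Finset.sum_congr rfl fun i _ => by ring
  · exact (hG.sum_sub_mul_utilGrad_lt hβ hb a c hx).le

/-! ### Least attractiveness of a block as a function of its markup -/

section Block

variable {m N : ℕ} {part : Fin m → Fin N} {Gn : ∀ n, (Block part n → ℝ) → ℝ} {c : Fin m → ℝ}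
  {An : ∀ n, Set ((Block part n → ℝ) × (Block part n → ℝ))} {n : Fin N}

/-- The logarithm of the `n`-th generating function at markup zero. With a common price sensitivity
`β`, the `n`-th generating function at the markup `t` is `exp (level - β * t)`. -/
noncomputable def level (Gn : ∀ n, (Block part n → ℝ) → ℝ) (c : Fin m → ℝ) (n : Fin N)
    (ab : (Block part n → ℝ) × (Block part n → ℝ)) : ℝ :=
  Real.log (utilGen (Gn n) fun i => ab.1 i - ab.2 i * c i.1)

/-- The price sensitivities in `K` are positive, and equal for all products. -/
def IsHomogeneousPos {ι : Type*} (K : Set ((ι → ℝ) × (ι → ℝ))) : Prop :=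
  ∀ ab ∈ K, (∀ i, 0 < ab.2 i) ∧ ∀ i j, ab.2 i = ab.2 j

lemma blockG_eq_utilGen (t : ℝ) (ab : (Block part n → ℝ) × (Block part n → ℝ)) :
    blockG Gn c n t ab = utilGen (Gn n) fun i => ab.1 i - ab.2 i * (t + c i.1) := rfl

lemma blockG_nonneg (hG : IsGEV (Gn n)) (t : ℝ) (ab : (Block part n → ℝ) × (Block part n → ℝ)) :
    0 ≤ blockG Gn c n t ab := hG.utilGen_nonneg _

lemma blockG_pos (hG : IsGEV (Gn n)) (r : Block part n) (t : ℝ)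
    (ab : (Block part n → ℝ) × (Block part n → ℝ)) : 0 < blockG Gn c n t ab :=
  have : Nonempty (Block part n) := ⟨r⟩
  hG.utilGen_pos _

lemma blockG_eq_exp (hG : IsGEV (Gn n)) (r : Block part n) (t : ℝ)
    {ab : (Block part n → ℝ) × (Block part n → ℝ)} (hab : ∀ i j, ab.2 i = ab.2 j) :
    blockG Gn c n t ab = Real.exp (level Gn c n ab - ab.2 r * t) := by
  have : Nonempty (Block part n) := ⟨r⟩
  have h : (fun i : Block part n => ab.1 i - ab.2 i * (t + c i.1)) =
      fun i => (ab.1 i - ab.2 i * c i.1) + -(ab.2 r * t) := by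
    funext i
    rw [hab r i]
    ring
  rw [blockG_eq_utilGen, h, hG.utilGen_add_const, sub_eq_add_neg, Real.exp_add, level,
    Real.exp_log (hG.utilGen_pos _), mul_comm]

lemma continuous_blockG (hG : IsGEV (Gn n)) :
    Continuous fun p : ℝ × ((Block part n → ℝ) × (Block part n → ℝ)) =>
      blockG Gn c n p.1 p.2 :=
  hG.continuous_utilGen.comp (by fun_prop)

lemma convexOn_blockG (hG : IsGEV (Gn n)) (hK : Convex ℝ (An n)) (t : ℝ) :
    ConvexOn ℝ (An n) (blockG Gn c n t) := by
  refine ⟨hK, fun x _ y _ s s' hs hs' hss => ?_⟩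
  have h := hG.convexOn_utilGen.2 (Set.mem_univ fun i => x.1 i - x.2 i * (t + c i.1))
    (Set.mem_univ fun i => y.1 i - y.2 i * (t + c i.1)) hs hs' hss
  refine le_trans (le_of_eq ?_) h
  rw [blockG_eq_utilGen]
  congr 1
  funext i
  simp only [Prod.fst_add, Prod.snd_add, Prod.smul_fst, Prod.smul_snd, Pi.add_apply,
    Pi.smul_apply, smul_eq_mul]
  ring

lemma continuous_level (hG : IsGEV (Gn n)) (r : Block part n) : Continuous (level Gn c n) := by
  have : Nonempty (Block part n) := ⟨r⟩
  exact (hG.continuous_utilGen.comp (by fun_prop)).log fun ab => (hG.utilGen_pos _).ne'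

lemma convexOn_level (hG : IsGEV (Gn n)) (r : Block part n) (hK : Convex ℝ (An n)) :
    ConvexOn ℝ (An n) (level Gn c n) := by
  have : Nonempty (Block part n) := ⟨r⟩
  refine ⟨hK, fun x _ y _ s s' hs hs' hss => ?_⟩
  have h := hG.convexOn_log_utilGen.2 (Set.mem_univ fun i => x.1 i - x.2 i * c i.1)
    (Set.mem_univ fun i => y.1 i - y.2 i * c i.1) hs hs' hss
  refine le_trans (le_of_eq ?_) h
  rw [level]
  congr 2
  funext i
  simp only [Prod.fst_add, Prod.snd_add, Prod.smul_fst, Prod.smul_snd, Pi.add_apply,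
    Pi.smul_apply, smul_eq_mul]
  ring

lemma isLeast_minBlockG (hG : IsGEV (Gn n)) (hK : IsCompact (An n)) (hne : (An n).Nonempty)
    (t : ℝ) : IsLeast (blockG Gn c n t '' An n) (minBlockG Gn c An n t) :=
  (hK.image ((continuous_blockG hG).comp (by fun_prop : Continuous fun ab => (t, ab)))).isLeast_sInf
    (hne.image _)

lemma continuous_minBlockG (hG : IsGEV (Gn n)) (hK : IsCompact (An n)) :
    Continuous (minBlockG Gn c An n) :=
  hK.continuous_sInf (continuous_blockG hG)

lemma minBlockG_pos (hG : IsGEV (Gn n)) (r : Block part n) (hK : IsCompact (An n))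
    (hne : (An n).Nonempty) (t : ℝ) : 0 < minBlockG Gn c An n t := by
  obtain ⟨ab, -, h⟩ := (isLeast_minBlockG (c := c) hG hK hne t).1
  exact h ▸ blockG_pos hG r t ab

lemma strictAnti_minBlockG (hG : IsGEV (Gn n)) (r : Block part n) (hK : IsCompact (An n))
    (hne : (An n).Nonempty) (hh : IsHomogeneousPos (An n)) : StrictAnti (minBlockG Gn c An n) := by
  intro s t hst
  obtain ⟨ab, hab, h⟩ := (isLeast_minBlockG (c := c) hG hK hne s).1
  refine ((isLeast_minBlockG hG hK hne t).2 ⟨ab, hab, rfl⟩).trans_lt ?_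
  rw [← h, blockG_eq_exp hG r _ (hh ab hab).2, blockG_eq_exp hG r _ (hh ab hab).2]
  gcongr
  exact (hh ab hab).1 r

/-- The markup at which the least attractiveness of a block equals `q` is the minimum over the
parameters of the markups at which the attractiveness equals `q`. -/
lemma minBlockG_eq_iff (hG : IsGEV (Gn n)) (r : Block part n) (hK : IsCompact (An n))
    (hne : (An n).Nonempty) (hh : IsHomogeneousPos (An n)) {q t : ℝ} (hq : 0 < q) :
    minBlockG Gn c An n t = q ↔
      IsLeast ((fun ab => (level Gn c n ab - Real.log q) / ab.2 r) '' An n) t := by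
  have hle : ∀ ab ∈ An n, q ≤ blockG Gn c n t ab ↔ t ≤ (level Gn c n ab - Real.log q) / ab.2 r :=
    fun ab hab => by
      rw [blockG_eq_exp hG r _ (hh ab hab).2, ← Real.log_le_iff_le_exp hq,
        le_div_iff₀ ((hh ab hab).1 r)]
      constructor <;> intro h <;> linarith
  have heq : ∀ ab ∈ An n, blockG Gn c n t ab = q ↔
      (level Gn c n ab - Real.log q) / ab.2 r = t := fun ab hab => by
    rw [blockG_eq_exp hG r _ (hh ab hab).2, div_eq_iff ((hh ab hab).1 r).ne', eq_comm,
      ← Real.log_injOn_pos.eq_iff hq (Real.exp_pos _), Real.log_exp]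
    constructor <;> intro h <;> linarith
  have hleast : minBlockG Gn c An n t = q ↔ IsLeast (blockG Gn c n t '' An n) q :=
    ⟨fun h => h ▸ isLeast_minBlockG hG hK hne t,
      fun h => (isLeast_minBlockG hG hK hne t).unique h⟩
  rw [hleast]
  constructor
  · rintro ⟨⟨ab, hab, h⟩, hlb⟩
    refine ⟨⟨ab, hab, (heq ab hab).1 h⟩, ?_⟩
    rintro _ ⟨ab', hab', rfl⟩
    exact (hle ab' hab').1 (hlb ⟨ab', hab', rfl⟩)
  · rintro ⟨⟨ab, hab, h⟩, hlb⟩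
    refine ⟨⟨ab, hab, (heq ab hab).2 h⟩, ?_⟩
    rintro _ ⟨ab', hab', rfl⟩
    exact (hle ab' hab').2 (hlb ⟨ab', hab', rfl⟩)

lemma exists_minBlockG_eq (hG : IsGEV (Gn n)) (r : Block part n) (hK : IsCompact (An n))
    (hne : (An n).Nonempty) (hh : IsHomogeneousPos (An n)) {q : ℝ} (hq : 0 < q) :
    ∃ t, minBlockG Gn c An n t = q := by
  have hc : ContinuousOn (fun ab => (level Gn c n ab - Real.log q) / ab.2 r) (An n) :=
    ((continuous_level hG r).continuousOn.sub continuousOn_const).div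
      (by fun_prop) fun ab hab => ((hh ab hab).1 r).ne'
  exact ⟨_, (minBlockG_eq_iff hG r hK hne hh hq).2
    ((hK.image_of_continuousOn hc).isLeast_sInf (hne.image _))⟩

end Block

/-! ### The reduced problem in terms of purchase probabilities -/

section Reduced

variable {m N : ℕ} {part : Fin m → Fin N} {Gn : ∀ n, (Block part n → ℝ) → ℝ} {c : Fin m → ℝ}
  {An : ∀ n, Set ((Block part n → ℝ) × (Block part n → ℝ))}

lemma div_mem_probSet {g : Fin N → ℝ} (hg : ∀ n, 0 < g n) :
    (fun n => g n / (1 + ∑ l, g l)) ∈ probSet N := by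
  have h : 0 < 1 + ∑ l, g l := add_pos_of_pos_of_nonneg one_pos
    (Finset.sum_nonneg fun n _ => (hg n).le)
  refine ⟨fun n => div_pos (hg n) h, ?_⟩
  rw [← Finset.sum_div, div_lt_one h]
  linarith

lemma div_one_sub_sum_div {g : Fin N → ℝ} (hg : ∀ n, 0 < g n) (n : Fin N) :
    (g n / (1 + ∑ l, g l)) / (1 - ∑ k, g k / (1 + ∑ l, g l)) = g n := by
  have h : 0 < 1 + ∑ l, g l := add_pos_of_pos_of_nonneg one_pos
    (Finset.sum_nonneg fun n _ => (hg n).le)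
  have h1 : 1 - ∑ k, g k / (1 + ∑ l, g l) = 1 / (1 + ∑ l, g l) := by
    rw [← Finset.sum_div]
    field_simp
    ring
  rw [h1]
  field_simp

lemma convex_probSet : Convex ℝ (probSet N) := by
  refine fun p hp p' hp' s t hs ht hst => ⟨fun n => ?_, ?_⟩
  · simp only [Pi.add_apply, Pi.smul_apply, smul_eq_mul]
    rcases hs.eq_or_lt with rfl | hs
    · simpa [show t = 1 by linarith] using hp'.1 n
    · exact add_pos_of_pos_of_nonneg (mul_pos hs (hp.1 n)) (mul_nonneg ht (hp'.1 n).le)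
  · simp only [Pi.add_apply, Pi.smul_apply, smul_eq_mul, Finset.sum_add_distrib,
      ← Finset.mul_sum]
    have h1 := hp.2
    have h2 := hp'.2
    rcases hs.eq_or_lt with rfl | hs
    · simpa [show t = 1 by linarith] using h2
    · nlinarith

/-- The ratios of the purchase probabilities and the no-purchase probability determine the
former. -/
lemma eq_of_div_one_sub_sum_eq {p p' : Fin N → ℝ} (hp : p ∈ probSet N) (hp' : p' ∈ probSet N)
    (h : ∀ n, p n / (1 - ∑ l, p l) = p' n / (1 - ∑ l, p' l)) : p = p' := by
  have h0 : 0 < 1 - ∑ l, p l := sub_pos.2 hp.2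
  have h0' : 0 < 1 - ∑ l, p' l := sub_pos.2 hp'.2
  have h1 : (∑ l, p l) / (1 - ∑ l, p l) = (∑ l, p' l) / (1 - ∑ l, p' l) := by
    rw [Finset.sum_div, Finset.sum_div]
    exact Finset.sum_congr rfl fun n _ => h n
  have h2 : 1 - ∑ l, p l = 1 - ∑ l, p' l := by
    rw [div_eq_div_iff h0.ne' h0'.ne'] at h1
    linarith
  funext n
  have := h n
  rw [h2] at this
  exact (div_left_inj' h0'.ne').1 this

lemma reducedRevenue_eq_sum {z p : Fin N → ℝ} (h : purchaseProb Gn c An z = p) :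
    reducedRevenue Gn c An z = ∑ n, z n * p n := by
  subst h
  rw [reducedRevenue, Finset.sum_div]
  exact Finset.sum_congr rfl fun n _ => mul_div_assoc _ _ _

variable (hGn : ∀ n, IsGEV (Gn n)) (r : ∀ n, Block part n) (hne : ∀ n, (An n).Nonempty)
  (hcomp : ∀ n, IsCompact (An n)) (hh : ∀ n, IsHomogeneousPos (An n))

include hGn r hne hcomp

lemma purchaseProb_mem (z : Fin N → ℝ) : purchaseProb Gn c An z ∈ probSet N :=
  div_mem_probSet fun n => minBlockG_pos (hGn n) (r n) (hcomp n) (hne n) (z n)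

lemma minBlockG_eq_of_purchaseProb_eq {z p : Fin N → ℝ} (h : purchaseProb Gn c An z = p)
    (n : Fin N) : minBlockG Gn c An n (z n) = p n / (1 - ∑ l, p l) := by
  subst h
  exact (div_one_sub_sum_div (g := fun n => minBlockG Gn c An n (z n))
    (fun n => minBlockG_pos (hGn n) (r n) (hcomp n) (hne n) (z n)) n).symm

include hh

lemma injective_purchaseProb : Function.Injective (purchaseProb Gn c An) := fun z z' h => by
  funext n
  refine (strictAnti_minBlockG (c := c) (hGn n) (r n) (hcomp n) (hne n) (hh n)).injective ?_
  rw [minBlockG_eq_of_purchaseProb_eq hGn r hne hcomp h,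
    minBlockG_eq_of_purchaseProb_eq hGn r hne hcomp rfl]

lemma exists_purchaseProb_eq {p : Fin N → ℝ} (hp : p ∈ probSet N) :
    ∃ z, purchaseProb Gn c An z = p := by
  have h0 : 0 < 1 - ∑ l, p l := sub_pos.2 hp.2
  choose z hz using fun n => exists_minBlockG_eq (c := c) (hGn n) (r n) (hcomp n) (hne n) (hh n)
    (div_pos (hp.1 n) h0)
  refine ⟨z, funext fun n => ?_⟩
  simp only [purchaseProb, hz]
  rw [← Finset.sum_div]
  field_simp
  ring

lemma bijOn_purchaseProb : Set.BijOn (purchaseProb Gn c An) Set.univ (probSet N) :=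
  ⟨fun z _ => purchaseProb_mem hGn r hne hcomp z,
    (injective_purchaseProb hGn r hne hcomp hh).injOn,
    fun _ hp => (exists_purchaseProb_eq hGn r hne hcomp hh hp).imp fun _ hz => ⟨trivial, hz⟩⟩

lemma reducedRevenueOfProb_purchaseProb (z : Fin N → ℝ) :
    reducedRevenueOfProb Gn c An (purchaseProb Gn c An z) = reducedRevenue Gn c An z := by
  rw [reducedRevenueOfProb,
    Function.leftInverse_invFun (injective_purchaseProb hGn r hne hcomp hh)]

/-- In terms of the purchase probabilities `p` and `p₀ = 1 - ∑ n, p n`, the revenue is the sum over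
`n` of the minima over the parameters of `(level * p n - p n * log (p n / p₀)) / β`, and these
functions are concave by the log-sum inequality. -/
lemma strictConcaveOn_reducedRevenueOfProb :
    StrictConcaveOn ℝ (probSet N) (reducedRevenueOfProb Gn c An) := by
  refine ⟨convex_probSet, fun p hp p' hp' hpp s t hs ht hst => ?_⟩
  have hq := convex_probSet hp hp' hs.le ht.le hst
  set q := s • p + t • p' with hqdef
  obtain ⟨z, hz⟩ := exists_purchaseProb_eq (c := c) hGn r hne hcomp hh hp
  obtain ⟨z', hz'⟩ := exists_purchaseProb_eq (c := c) hGn r hne hcomp hh hp'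
  obtain ⟨y, hy⟩ := exists_purchaseProb_eq (c := c) hGn r hne hcomp hh hq
  have eval : ∀ {z p : Fin N → ℝ}, purchaseProb Gn c An z = p →
      reducedRevenueOfProb Gn c An p = ∑ n, z n * p n := fun {z p} h => by
    rw [← reducedRevenue_eq_sum h, ← h,
      reducedRevenueOfProb_purchaseProb hGn r hne hcomp hh]
  rw [eval hz, eval hz', eval hy]
  have h0 : 0 < 1 - ∑ l, p l := sub_pos.2 hp.2
  have h0' : 0 < 1 - ∑ l, p' l := sub_pos.2 hp'.2
  have hq0 : 1 - ∑ l, q l = s * (1 - ∑ l, p l) + t * (1 - ∑ l, p' l) := by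
    simp only [hqdef, Pi.add_apply, Pi.smul_apply, smul_eq_mul, Finset.sum_add_distrib,
      ← Finset.mul_sum]
    linear_combination (-1 : ℝ) * hst
  have hqn : ∀ n, q n = s * p n + t * p' n := fun n => rfl
  have markup : ∀ {z p : Fin N → ℝ}, p ∈ probSet N → purchaseProb Gn c An z = p → ∀ n,
      IsLeast ((fun ab => (level Gn c n ab - Real.log (p n / (1 - ∑ l, p l))) / ab.2 (r n)) ''
        An n) (z n) := fun {z p} hp h n =>
    (minBlockG_eq_iff (hGn n) (r n) (hcomp n) (hne n) (hh n)
      (div_pos (hp.1 n) (sub_pos.2 hp.2))).1 (minBlockG_eq_of_purchaseProb_eq hGn r hne hcomp h n)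
  -- the parameters that attain the minimum at the convex combination give an upper bound elsewhere
  have term : ∀ n, ∃ b : ℝ, 0 < b ∧ (s * (p n * Real.log (p n / (1 - ∑ l, p l))) +
        t * (p' n * Real.log (p' n / (1 - ∑ l, p' l))) -
        q n * Real.log (q n / (1 - ∑ l, q l))) / b ≤
      y n * q n - (s * (z n * p n) + t * (z' n * p' n)) := fun n => by
    obtain ⟨⟨ab, hab, hyn⟩, -⟩ := markup hq hy n
    have hb := (hh n ab hab).1 (r n)
    have h1 := mul_le_mul_of_nonneg_right ((markup hp hz n).2 ⟨ab, hab, rfl⟩)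
      (mul_nonneg hs.le (hp.1 n).le)
    have h2 := mul_le_mul_of_nonneg_right ((markup hp' hz' n).2 ⟨ab, hab, rfl⟩)
      (mul_nonneg ht.le (hp'.1 n).le)
    refine ⟨ab.2 (r n), hb, ?_⟩
    simp only at hyn h1 h2
    have h3 : (s * (p n * Real.log (p n / (1 - ∑ l, p l))) +
        t * (p' n * Real.log (p' n / (1 - ∑ l, p' l))) -
        q n * Real.log (q n / (1 - ∑ l, q l))) / ab.2 (r n) = y n * q n -
        ((level Gn c n ab - Real.log (p n / (1 - ∑ l, p l))) / ab.2 (r n) * (s * p n) +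
        (level Gn c n ab - Real.log (p' n / (1 - ∑ l, p' l))) / ab.2 (r n) * (t * p' n)) := by
      rw [← hyn, hqn n]
      field_simp
      ring
    rw [h3]
    linarith
  simp only [smul_eq_mul]
  rw [Finset.mul_sum, Finset.mul_sum, ← Finset.sum_add_distrib]
  have hratio : ∃ n, p n / (1 - ∑ l, p l) ≠ p' n / (1 - ∑ l, p' l) := by
    by_contra! h
    exact hpp (eq_of_div_one_sub_sum_eq hp hp' h)
  refine Finset.sum_lt_sum (fun n _ => ?_) ?_
  · obtain ⟨b, hb, h⟩ := term n
    have h1 := mul_log_div_le (hp.1 n) h0 (hp'.1 n) h0' hs ht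
    rw [← hqn n, ← hq0] at h1
    have h2 := div_nonneg (sub_nonneg.2 h1) hb.le
    linarith
  · obtain ⟨n, hn⟩ := hratio
    refine ⟨n, Finset.mem_univ n, ?_⟩
    obtain ⟨b, hb, h⟩ := term n
    have h1 := mul_log_div_lt (hp.1 n) h0 (hp'.1 n) h0' hs ht hn
    rw [← hqn n, ← hq0] at h1
    have h2 := div_pos (sub_pos.2 h1) hb
    linarith

end Reduced

/-! ### Revenue of a separable model -/

section Separable

variable {m N : ℕ} {part : Fin m → Fin N} {G : (Fin m → ℝ) → ℝ}
  {Gn : ∀ n, (Block part n → ℝ) → ℝ} {c : Fin m → ℝ}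

lemma partialDeriv_eq_of_separable
    (hsep : ∀ Y ∈ posOrthant (Fin m), G Y = ∑ n, Gn n (restrict part n Y))
    {Y : Fin m → ℝ} (hY : Y ∈ posOrthant (Fin m)) (i : Fin m) :
    partialDeriv i G Y =
      partialDeriv (⟨i, rfl⟩ : Block part (part i)) (Gn (part i)) (restrict part (part i) Y) := by
  have heq : (fun t : ℝ => G (Y + t • Pi.single i 1)) =ᶠ[nhds 0] fun t =>
      (∑ n ∈ Finset.univ.erase (part i), Gn n (restrict part n Y)) +
        Gn (part i) (restrict part (part i) Y +
          t • Pi.single (⟨i, rfl⟩ : Block part (part i)) 1) := by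
    have hcont : Continuous fun t : ℝ => Y + t • (Pi.single i 1 : Fin m → ℝ) := by fun_prop
    have hmem : ∀ᶠ t in nhds (0 : ℝ), Y + t • (Pi.single i 1 : Fin m → ℝ) ∈ posOrthant (Fin m) :=
      hcont.continuousAt.eventually_mem (isOpen_posOrthant.mem_nhds (by simpa using hY))
    filter_upwards [hmem] with t ht
    rw [hsep _ ht, ← Finset.sum_erase_add _ _ (Finset.mem_univ (part i))]
    congr 1
    · refine Finset.sum_congr rfl fun n hn => ?_
      congr 1
      funext j
      have hj : j.1 ≠ i := by
        rintro rfl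
        exact Finset.ne_of_mem_erase hn j.2.symm
      simp [restrict, hj]
    · congr 1
      funext j
      simp [restrict, Pi.single_apply, Subtype.ext_iff]
  unfold partialDeriv lineDeriv
  rw [heq.deriv_eq, deriv_const_add']

/-- For a separable model the revenue is a ratio of sums over the blocks. -/
lemma revenue_eq_div (hsep : ∀ Y ∈ posOrthant (Fin m), G Y = ∑ n, Gn n (restrict part n Y))
    (x : Fin m → ℝ) (ab : (Fin m → ℝ) × (Fin m → ℝ)) :
    revenue G c x ab =
      (∑ n, ∑ i : Block part n, (x i.1 - c i.1) *
        utilGrad (Gn n) (fun j : Block part n => ab.1 j.1 - ab.2 j.1 * x j.1) i) /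
      (1 + ∑ n, utilGen (Gn n) fun j : Block part n => ab.1 j.1 - ab.2 j.1 * x j.1) := by
  have hY := exp_mem_posOrthant fun j => ab.1 j - ab.2 j * x j
  have hden : G (fun j => Real.exp (ab.1 j - ab.2 j * x j)) =
      ∑ n, utilGen (Gn n) fun j : Block part n => ab.1 j.1 - ab.2 j.1 * x j.1 := hsep _ hY
  simp only [revenue, choiceProb]
  rw [hden, ← Fintype.sum_fiberwise part, Finset.sum_div]
  refine Finset.sum_congr rfl fun n _ => ?_
  rw [Finset.sum_div]
  refine Finset.sum_congr rfl fun i _ => ?_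
  obtain ⟨i, rfl⟩ := i
  rw [partialDeriv_eq_of_separable hsep hY, ← mul_div_assoc]
  rfl

lemma continuous_revenue (hG : IsGEV G) (x : Fin m → ℝ) : Continuous (revenue G c x) := by
  have hu : Continuous fun (ab : (Fin m → ℝ) × (Fin m → ℝ)) (j : Fin m) =>
      ab.1 j - ab.2 j * x j := by fun_prop
  refine continuous_finsetSum _ fun i _ => continuous_const.mul
    (((hG.continuous_utilGrad i).comp hu).div
      (continuous_const.add (hG.continuous_utilGen.comp hu)) fun ab => ?_)
  exact (add_pos_of_pos_of_nonneg one_pos (hG.utilGen_nonneg _)).ne'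

lemma revenue_markupPrice (hGn : ∀ n, IsGEV (Gn n))
    (hsep : ∀ Y ∈ posOrthant (Fin m), G Y = ∑ n, Gn n (restrict part n Y))
    (z : Fin N → ℝ) (ab : (Fin m → ℝ) × (Fin m → ℝ)) :
    revenue G c (markupPrice part c z) ab = markupRevenue Gn c z ab := by
  have hw : ∀ n, (fun j : Block part n =>
      ab.1 j.1 - ab.2 j.1 * markupPrice part c z j.1) = fun j =>
        (restrictParam part n ab).1 j - (restrictParam part n ab).2 j * (z n + c j.1) := fun n => by
    funext ⟨j, hj⟩
    subst hj
    rfl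
  rw [revenue_eq_div hsep, markupRevenue]
  simp only [hw, blockG_eq_utilGen]
  congr 1
  refine Finset.sum_congr rfl fun n _ => ?_
  rw [← (hGn n).sum_utilGrad, Finset.mul_sum]
  refine Finset.sum_congr rfl fun i _ => ?_
  obtain ⟨i, rfl⟩ := i
  simp [markupPrice]

lemma markupPrice_injective (hpart : Function.Surjective part) :
    Function.Injective (markupPrice part c) := fun z z' h => by
  funext n
  obtain ⟨i, rfl⟩ := hpart n
  exact add_right_cancel (congrFun h i)

lemma one_add_sum_utilGen_pos (hGn : ∀ n, IsGEV (Gn n)) (w : ∀ n, Block part n → ℝ) :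
    0 < 1 + ∑ n, utilGen (Gn n) (w n) :=
  add_pos_of_pos_of_nonneg one_pos (Finset.sum_nonneg fun n _ => (hGn n).utilGen_nonneg _)

lemma peak_level_eq {n : Fin N} (hG : IsGEV (Gn n)) (r : Block part n) {lam : ℝ}
    {ab : (Block part n → ℝ) × (Block part n → ℝ)}
    (hab : (∀ i, 0 < ab.2 i) ∧ ∀ i j, ab.2 i = ab.2 j) :
    peak (level Gn c n ab) (ab.2 r) lam = blockG Gn c n (lam + 1 / ab.2 r) ab / ab.2 r := by
  rw [blockG_eq_exp hG r _ hab.2, ← sub_mul_exp_eq_peak (hab.1 r)]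
  ring

section KnownParameters

variable (hGn : ∀ n, IsGEV (Gn n)) (r : ∀ n, Block part n)
  {ab : (Fin m → ℝ) × (Fin m → ℝ)}
  (hab : ∀ n, (∀ i, 0 < (restrictParam part n ab).2 i) ∧
    ∀ i j, (restrictParam part n ab).2 i = (restrictParam part n ab).2 j)

include hGn hab

lemma sum_block_le_peak (x : Fin m → ℝ) (lam : ℝ) (n : Fin N) :
    ∑ i : Block part n, (x i.1 - c i.1 - lam) *
        utilGrad (Gn n) (fun j : Block part n => ab.1 j.1 - ab.2 j.1 * x j.1) i ≤
      peak (level Gn c n (restrictParam part n ab)) ((restrictParam part n ab).2 (r n)) lam := by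
  rw [peak_level_eq (hGn n) _ (hab n)]
  exact (hGn n).sum_sub_mul_utilGrad_le ((hab n).1 (r n)) (fun i => (hab n).2 i (r n))
    (restrictParam part n ab).1 (fun i => c i.1) (fun i => x i.1)

lemma sum_block_lt_peak {x : Fin m → ℝ} {lam : ℝ} {n : Fin N}
    (hx : ∃ i : Block part n, x i.1 ≠ lam + 1 / (restrictParam part n ab).2 (r n) + c i.1) :
    ∑ i : Block part n, (x i.1 - c i.1 - lam) *
        utilGrad (Gn n) (fun j : Block part n => ab.1 j.1 - ab.2 j.1 * x j.1) i <
      peak (level Gn c n (restrictParam part n ab)) ((restrictParam part n ab).2 (r n)) lam := by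
  rw [peak_level_eq (hGn n) _ (hab n)]
  obtain ⟨i, hi⟩ := hx
  exact (hGn n).sum_sub_mul_utilGrad_lt ((hab n).1 (r n)) (fun i => (hab n).2 i (r n))
    (restrictParam part n ab).1 (fun i => c i.1) (x := fun i => x i.1)
    fun h => hi (congrFun h i)

variable (hsep : ∀ Y ∈ posOrthant (Fin m), G Y = ∑ n, Gn n (restrict part n Y))
  {lam : ℝ}
  (hlam : ∑ n, peak (level Gn c n (restrictParam part n ab)) ((restrictParam part n ab).2 (r n)) lam
    = lam)

include hsep hlam

/-- Under known parameters, the revenue is at most the `lam` for which the peak profits of the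
blocks add up to `lam`: the revenue is a ratio, which is at most `lam` iff the numerator minus `lam`
times the denominator is nonpositive, and this difference separates over the blocks. -/
lemma revenue_le_of_sum_peak_eq (x : Fin m → ℝ) : revenue G c x ab ≤ lam := by
  have h := Finset.sum_le_sum fun n (_ : n ∈ Finset.univ) => sum_block_le_peak (c := c) hGn r hab x lam n
  rw [hlam] at h
  simp only [sub_mul _ lam, Finset.sum_sub_distrib, ← Finset.mul_sum, (hGn _).sum_utilGrad] at h
  rw [revenue_eq_div hsep, div_le_iff₀ (one_add_sum_utilGen_pos hGn _)]
  linarith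

lemma revenue_lt_of_sum_peak_eq {x : Fin m → ℝ}
    (hx : x ≠ markupPrice part c fun n => lam + 1 / (restrictParam part n ab).2 (r n)) :
    revenue G c x ab < lam := by
  obtain ⟨i, hi⟩ := Function.ne_iff.1 hx
  have h := Finset.sum_lt_sum
    (fun n (_ : n ∈ Finset.univ) => sum_block_le_peak (c := c) hGn r hab x lam n)
    ⟨part i, Finset.mem_univ _, sum_block_lt_peak hGn r hab ⟨⟨i, rfl⟩, hi⟩⟩
  rw [hlam] at h
  simp only [sub_mul _ lam, Finset.sum_sub_distrib, ← Finset.mul_sum, (hGn _).sum_utilGrad] at h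
  rw [revenue_eq_div hsep, div_lt_iff₀ (one_add_sum_utilGen_pos hGn _)]
  linarith

end KnownParameters

lemma le_div_one_add_sum_iff {ν : Type*} [Fintype ν] {g z : ν → ℝ} (hg : ∀ n, 0 ≤ g n) {lam : ℝ} :
    lam ≤ (∑ n, z n * g n) / (1 + ∑ n, g n) ↔ lam ≤ ∑ n, (z n - lam) * g n := by
  have h : 0 < 1 + ∑ n, g n :=
    add_pos_of_pos_of_nonneg one_pos (Finset.sum_nonneg fun n _ => hg n)
  simp only [sub_mul, Finset.sum_sub_distrib, ← Finset.mul_sum]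
  rw [le_div_iff₀ h]
  constructor <;> intro h <;> linarith

end Separable

/-! ### The product uncertainty set -/

section Product

variable {m N : ℕ} {part : Fin m → Fin N}

/-- The parameters with given sub-vectors over the blocks. -/
def glue (e : ∀ n, (Block part n → ℝ) × (Block part n → ℝ)) : (Fin m → ℝ) × (Fin m → ℝ) :=
  (fun i => (e (part i)).1 ⟨i, rfl⟩, fun i => (e (part i)).2 ⟨i, rfl⟩)

lemma restrictParam_glue (e : ∀ n, (Block part n → ℝ) × (Block part n → ℝ)) (n : Fin N) :
    restrictParam part n (glue e) = e n := by
  ext ⟨i, rfl⟩ <;> rfl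

lemma glue_restrictParam (ab : (Fin m → ℝ) × (Fin m → ℝ)) :
    glue (fun n => restrictParam part n ab) = ab := rfl

lemma continuous_glue :
    Continuous (glue : (∀ n, (Block part n → ℝ) × (Block part n → ℝ)) → _) := by
  unfold glue
  fun_prop

variable {A : Set ((Fin m → ℝ) × (Fin m → ℝ))}
  {An : ∀ n, Set ((Block part n → ℝ) × (Block part n → ℝ))}
  (hA : ∀ ab, ab ∈ A ↔ ∀ n, restrictParam part n ab ∈ An n)
include hA

lemma glue_mem {e : ∀ n, (Block part n → ℝ) × (Block part n → ℝ)} (he : ∀ n, e n ∈ An n) :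
    glue e ∈ A := (hA _).2 fun n => by rw [restrictParam_glue]; exact he n

lemma exists_mem_restrictParam_eq (hne : ∀ n, (An n).Nonempty) {n : Fin N}
    {e : (Block part n → ℝ) × (Block part n → ℝ)} (he : e ∈ An n) :
    ∃ ab ∈ A, restrictParam part n ab = e := by
  choose e₀ he₀ using hne
  refine ⟨glue (Function.update e₀ n e), glue_mem hA fun l => ?_, ?_⟩
  · rcases eq_or_ne l n with rfl | hl
    · simpa using he
    · simpa [hl] using he₀ l
  · simp [restrictParam_glue]

lemma isCompact_of_forall_isCompact (hcomp : ∀ n, IsCompact (An n)) : IsCompact A := by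
  have h : A = glue '' Set.univ.pi An := by
    ext ab
    constructor
    · exact fun h => ⟨_, fun n _ => (hA ab).1 h n, glue_restrictParam ab⟩
    · rintro ⟨e, he, rfl⟩
      exact glue_mem hA fun n => he n trivial
  rw [h]
  exact (isCompact_univ_pi hcomp).image continuous_glue

lemma isHomogeneousPos_of_forall (hne : ∀ n, (An n).Nonempty) (hpos : ∀ ab ∈ A, ∀ i, 0 < ab.2 i)
    (hhom : ∀ ab ∈ A, ∀ i j, part i = part j → ab.2 i = ab.2 j) (n : Fin N) :
    IsHomogeneousPos (An n) := fun e he => by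
  obtain ⟨ab, hab, rfl⟩ := exists_mem_restrictParam_eq hA hne he
  exact ⟨fun i => hpos ab hab i.1, fun i j => hhom ab hab i.1 j.1 (i.2.trans j.2.symm)⟩

end Product

lemma isMaxOn_univ_iff_eq {X : Type*} {f : X → ℝ} {x₀ : X} {v : ℝ} (h₀ : f x₀ = v)
    (h : ∀ x, x ≠ x₀ → f x < v) (x : X) : IsMaxOn f Set.univ x ↔ x = x₀ := by
  constructor
  · intro hx
    by_contra hne
    exact ((h x hne).trans_eq h₀.symm).not_ge
      (isMaxOn_iff.1 hx x₀ (Set.mem_univ x₀))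
  · rintro rfl
    refine isMaxOn_iff.2 fun y _ => ?_
    rcases eq_or_ne y x with rfl | hy
    · exact le_rfl
    · exact ((h y hy).trans_eq h₀.symm).le

/-! ### Saddle point -/

section Saddle

variable {m N : ℕ} {part : Fin m → Fin N} {Gn : ∀ n, (Block part n → ℝ) → ℝ}
  {c : Fin m → ℝ} {An : ∀ n, Set ((Block part n → ℝ) × (Block part n → ℝ))}
  (hGn : ∀ n, IsGEV (Gn n)) (r : ∀ n, Block part n) (hne : ∀ n, (An n).Nonempty)
  (hcomp : ∀ n, IsCompact (An n)) (hh : ∀ n, IsHomogeneousPos (An n))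

include hGn r hne hcomp hh

/-- The saddle point in the variables of the reduced problem: parameters that minimize the demand at
the markups `lam + 1 / β` that are optimal for them, at the optimal value `lam`. -/
lemma exists_sum_peak_level_eq (hconv : ∀ n, Convex ℝ (An n)) :
    ∃ (lam : ℝ) (e : ∀ n, (Block part n → ℝ) × (Block part n → ℝ)), (∀ n, e n ∈ An n) ∧
      (∀ n, IsMinOn (blockG Gn c n (lam + 1 / (e n).2 (r n))) (An n) (e n)) ∧
      ∑ n, peak (level Gn c n (e n)) ((e n).2 (r n)) lam = lam := by
  obtain ⟨lam, e, he, hmin, hsum⟩ := exists_sum_peak_eq (K := An) (k := level Gn c)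
    (β := fun n e => e.2 (r n)) hcomp hne (fun n => (continuous_level (hGn n) (r n)).continuousOn)
    (fun n => by fun_prop) (fun n e he => (hh n e he).1 (r n))
  refine ⟨lam, e, he, fun n => isMinOn_iff.2 fun e' he' => ?_, hsum⟩
  rw [blockG_eq_exp (hGn n) (r n) _ (hh n _ (he n)).2, blockG_eq_exp (hGn n) (r n) _ (hh n _ he').2,
    Real.exp_le_exp]
  obtain ⟨L, hL⟩ : ∃ L : (Block part n → ℝ) × (Block part n → ℝ) →ₗ[ℝ] ℝ,
      ∀ e, L e = e.2 (r n) :=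
    ⟨LinearMap.proj (r n) ∘ₗ LinearMap.snd ℝ _ _, fun _ => rfl⟩
  have hfst := sub_mul_le_of_isMinOn_peak (convexOn_level (c := c) (hGn n) (r n) (hconv n)) L
    (fun e he => by rw [hL]; exact (hh n e he).1 (r n)) (lam := lam) (he n) he'
    (by simpa only [hL] using hmin n)
  simpa only [hL] using hfst

/-- The reduced problem has no other solution than the markups `lam + 1 / β`: block by block, the
profit `(t - lam) * g t` of a markup `t ≥ lam` is at most the one under the parameters `e n`, where
`g` is the least demand, and a markup `t < lam` incurs a loss. -/
lemma reducedRevenue_lt {e : ∀ n, (Block part n → ℝ) × (Block part n → ℝ)} (he : ∀ n, e n ∈ An n)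
    {lam : ℝ} (hsum : ∑ n, peak (level Gn c n (e n)) ((e n).2 (r n)) lam = lam) {z : Fin N → ℝ}
    (hz : z ≠ fun n => lam + 1 / (e n).2 (r n)) : reducedRevenue Gn c An z < lam := by
  have hpos : ∀ n, 0 < minBlockG Gn c An n (z n) := fun n =>
    minBlockG_pos (hGn n) (r n) (hcomp n) (hne n) (z n)
  have hlt : ∀ n, z n ≠ lam + 1 / (e n).2 (r n) → (z n - lam) * minBlockG Gn c An n (z n) <
      peak (level Gn c n (e n)) ((e n).2 (r n)) lam := fun n hn => by
    have hb := (hh n _ (he n)).1 (r n)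
    rcases lt_or_ge (z n) lam with h | h
    · exact (mul_neg_of_neg_of_pos (sub_neg.2 h) (hpos n)).trans (peak_pos hb)
    · refine lt_of_le_of_lt (mul_le_mul_of_nonneg_left ?_ (sub_nonneg.2 h))
        (sub_mul_exp_lt_peak hb hn)
      rw [← blockG_eq_exp (hGn n) (r n) _ (hh n _ (he n)).2]
      exact (isLeast_minBlockG (hGn n) (hcomp n) (hne n) _).2 ⟨_, he n, rfl⟩
  have hle : ∀ n, (z n - lam) * minBlockG Gn c An n (z n) ≤
      peak (level Gn c n (e n)) ((e n).2 (r n)) lam := fun n => by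
    by_cases hn : z n = lam + 1 / (e n).2 (r n)
    · have hb := (hh n _ (he n)).1 (r n)
      rw [← sub_mul_exp_eq_peak hb, ← hn, ← blockG_eq_exp (hGn n) (r n) _ (hh n _ (he n)).2]
      refine mul_le_mul_of_nonneg_left
        ((isLeast_minBlockG (hGn n) (hcomp n) (hne n) _).2 ⟨_, he n, rfl⟩) ?_
      rw [hn]
      simpa using hb.le
    · exact (hlt n hn).le
  obtain ⟨n, hn⟩ := Function.ne_iff.1 hz
  have h := Finset.sum_lt_sum (fun n (_ : n ∈ Finset.univ) => hle n) ⟨n, Finset.mem_univ n, hlt n hn⟩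
  rw [hsum] at h
  exact not_le.1 fun h' => h.not_ge ((le_div_one_add_sum_iff fun n => (hpos n).le).1 h')

end Saddle

end RobustPricing

theorem theorem4 {m N : ℕ} (part : Fin m → Fin N) (hpart : Function.Surjective part)
    (c : Fin m → ℝ)
    -- a GEV generating function that is separable over the partitions
    (G : (Fin m → ℝ) → ℝ) (hG : IsGEV G)
    (Gn : ∀ n, (Block part n → ℝ) → ℝ) (hGn : ∀ n, IsGEV (Gn n))
    (hsep : ∀ Y ∈ posOrthant (Fin m), G Y = ∑ n, Gn n (restrict part n Y))
    -- an uncertainty set that is the product of convex compact sets over the partitions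
    (A : Set ((Fin m → ℝ) × (Fin m → ℝ)))
    (An : ∀ n, Set ((Block part n → ℝ) × (Block part n → ℝ)))
    (hA : ∀ ab, ab ∈ A ↔ ∀ n, restrictParam part n ab ∈ An n)
    (hne : ∀ n, (An n).Nonempty) (hconv : ∀ n, Convex ℝ (An n)) (hcomp : ∀ n, IsCompact (An n))
    -- price sensitivities are positive and homogeneous within each partition
    (hpos : ∀ ab ∈ A, ∀ i, 0 < ab.2 i)
    (hhom : ∀ ab ∈ A, ∀ i j, part i = part j → ab.2 i = ab.2 j) :
    -- the inner minima are attained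
    (∀ x, IsLeast (revenue G c x '' A) (robustRevenue G c A x)) ∧
    (∀ z, IsLeast (markupRevenue Gn c z '' A) (robustMarkupRevenue Gn c A z)) ∧
    (∀ n t, IsLeast (blockG Gn c n t '' An n) (minBlockG Gn c An n t)) ∧
    ∃ z : Fin N → ℝ,
      -- the robust problem has exactly one optimal solution: markup `z n` in partition `n`
      (∀ x, IsMaxOn (robustRevenue G c A) Set.univ x ↔ x = markupPrice part c z) ∧
      -- `z` is the unique solution of the robust problem in the markups
      (∀ z', IsMaxOn (robustMarkupRevenue Gn c A) Set.univ z' ↔ z' = z) ∧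
      -- and of the reduced problem,
      (∀ z', IsMaxOn (reducedRevenue Gn c An) Set.univ z' ↔ z' = z) ∧
      -- which is a convex program in the purchase probabilities: the change of variables is
      -- bijective, the objective is strictly concave, `z` corresponds to its unique maximizer;
      Set.BijOn (purchaseProb Gn c An) Set.univ (probSet N) ∧
      StrictConcaveOn ℝ (probSet N) (reducedRevenueOfProb Gn c An) ∧
      (∀ p ∈ probSet N, IsMaxOn (reducedRevenueOfProb Gn c An) (probSet N) p ↔
        p = purchaseProb Gn c An z) ∧
      -- the minimal values that define it come from convex minimization, and they are continuous
      -- and strictly decreasing in the markup (so they can be inverted by bisection)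
      (∀ n t, ConvexOn ℝ (An n) (blockG Gn c n t)) ∧
      (∀ n, Continuous (minBlockG Gn c An n) ∧ StrictAnti (minBlockG Gn c An n)) ∧
      -- saddle point, with adversary parameters minimizing each `G^n` at the markup `z n`
      (∃ ab ∈ A, (∀ n, IsMinOn (blockG Gn c n (z n)) (An n) (restrictParam part n ab)) ∧
        IsSaddlePointOn A Set.univ (fun ab x => revenue G c x ab) ab (markupPrice part c z)) ∧
      -- minimax equality, all maxima and minima being attained
      (∀ ab ∈ A, IsGreatest (Set.range fun x => revenue G c x ab) (optimalRevenue G c ab)) ∧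
      (∃ v : ℝ, IsGreatest (Set.range (robustRevenue G c A)) v ∧
        IsLeast (optimalRevenue G c '' A) v) := by
  classical
  choose i₀ hi₀ using hpart
  let r : ∀ n, Block part n := fun n => ⟨i₀ n, hi₀ n⟩
  have hh := isHomogeneousPos_of_forall hA hne hpos hhom
  have hAcomp := isCompact_of_forall_isCompact hA hcomp
  have hAne : A.Nonempty := by
    choose e he using hne
    exact ⟨_, glue_mem hA he⟩
  have hR : ∀ x, IsLeast (revenue G c x '' A) (robustRevenue G c A x) := fun x =>
    (hAcomp.image (continuous_revenue hG x)).isLeast_sInf (hAne.image _)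
  have hmarkup : ∀ z, revenue G c (markupPrice part c z) = markupRevenue Gn c z := fun z =>
    funext (revenue_markupPrice hGn hsep z)
  have hρR : ∀ z, robustMarkupRevenue Gn c A z = robustRevenue G c A (markupPrice part c z) :=
    fun z => by rw [robustMarkupRevenue, robustRevenue, hmarkup]
  have hG' : ∀ n t, IsLeast (blockG Gn c n t '' An n) (minBlockG Gn c An n t) := fun n t =>
    isLeast_minBlockG (hGn n) (hcomp n) (hne n) t
  obtain ⟨lam, e, he, hmin, hsum⟩ := exists_sum_peak_level_eq (c := c) hGn r hne hcomp hh hconv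
  have hres : ∀ n, restrictParam part n (glue e) = e n := restrictParam_glue e
  set z : Fin N → ℝ := fun n => lam + 1 / (e n).2 (r n) with hz
  have hmem := glue_mem hA he
  have hhe : ∀ n, (∀ i, 0 < (restrictParam part n (glue e)).2 i) ∧
      ∀ i j, (restrictParam part n (glue e)).2 i = (restrictParam part n (glue e)).2 j :=
    fun n => by rw [hres]; exact hh n _ (he n)
  have hsum' : ∑ n, peak (level Gn c n (restrictParam part n (glue e)))
      ((restrictParam part n (glue e)).2 (r n)) lam = lam := by simpa only [hres] using hsum
  -- the two inequalities of the saddle point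
  have hle : ∀ x, revenue G c x (glue e) ≤ lam := revenue_le_of_sum_peak_eq hGn r hhe hsep hsum'
  have hlt : ∀ x, x ≠ markupPrice part c z → revenue G c x (glue e) < lam := fun x hx =>
    revenue_lt_of_sum_peak_eq hGn r hhe hsep hsum' (by simpa only [hres] using hx)
  have hge : ∀ ab ∈ A, lam ≤ revenue G c (markupPrice part c z) ab := fun ab hab => by
    rw [hmarkup, markupRevenue, le_div_one_add_sum_iff fun n => blockG_nonneg (hGn n) _ _]
    refine hsum.symm.le.trans (Finset.sum_le_sum fun n _ => ?_)
    have hb := (hh n _ (he n)).1 (r n)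
    rw [← sub_mul_exp_eq_peak hb, ← blockG_eq_exp (hGn n) (r n) _ (hh n _ (he n)).2]
    refine mul_le_mul_of_nonneg_left (isMinOn_iff.1 (hmin n) _ ((hA ab).1 hab n)) ?_
    simpa using hb.le
  have hval : revenue G c (markupPrice part c z) (glue e) = lam := le_antisymm (hle _) (hge _ hmem)
  have hRz : robustRevenue G c A (markupPrice part c z) = lam := by
    refine le_antisymm (((hR _).2 ⟨_, hmem, rfl⟩).trans (hle _)) ?_
    obtain ⟨ab, hab, h⟩ := (hR (markupPrice part c z)).1
    exact h ▸ hge ab hab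
  have hRlt : ∀ x, x ≠ markupPrice part c z → robustRevenue G c A x < lam := fun x hx =>
    ((hR x).2 ⟨_, hmem, rfl⟩).trans_lt (hlt x hx)
  have hRle : ∀ x, robustRevenue G c A x ≤ lam := fun x =>
    ((hR x).2 ⟨_, hmem, rfl⟩).trans (hle x)
  have hWz : reducedRevenue Gn c An z = lam := by
    have hg : ∀ n, minBlockG Gn c An n (z n) = blockG Gn c n (z n) (e n) := fun n =>
      (hG' n (z n)).unique ⟨⟨_, he n, rfl⟩, by
        rintro _ ⟨e', he', rfl⟩
        exact isMinOn_iff.1 (hmin n) e' he'⟩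
    rw [← hval, hmarkup]
    simp only [reducedRevenue, markupRevenue, hg, hres]
  have hWiff := isMaxOn_univ_iff_eq hWz fun z' hz' =>
    reducedRevenue_lt hGn r hne hcomp hh he hsum hz'
  -- the optimum under known parameters is the case of a singleton uncertainty set
  have hopt : ∀ ab ∈ A,
      IsGreatest (Set.range fun x => revenue G c x ab) (optimalRevenue G c ab) := by
    intro ab hab
    have hhab : ∀ n, IsHomogeneousPos {restrictParam part n ab} := fun n e he => by
      rw [Set.mem_singleton_iff.1 he]
      exact hh n _ ((hA ab).1 hab n)
    obtain ⟨μ, e', he', -, hμ⟩ := exists_sum_peak_level_eq (c := c)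
      (An := fun n => {restrictParam part n ab}) hGn r (fun n => Set.singleton_nonempty _)
      (fun n => isCompact_singleton) hhab (fun n => convex_singleton _)
    obtain rfl : e' = fun n => restrictParam part n ab := funext he'
    have hbound : ∀ x, revenue G c x ab ≤ μ :=
      revenue_le_of_sum_peak_eq hGn r (fun n => hhab n _ rfl) hsep hμ
    have hattain : revenue G c (markupPrice part c fun n =>
        μ + 1 / (restrictParam part n ab).2 (r n)) ab = μ := by
      refine le_antisymm (hbound _) ?_
      rw [hmarkup, markupRevenue, le_div_one_add_sum_iff fun n => blockG_nonneg (hGn n) _ _]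
      refine hμ.symm.le.trans (Finset.sum_le_sum fun n _ => ?_)
      rw [← sub_mul_exp_eq_peak ((hhab n _ rfl).1 (r n)),
        ← blockG_eq_exp (hGn n) (r n) _ (hhab n _ rfl).2]
    have hgreat : IsGreatest (Set.range fun x => revenue G c x ab) μ :=
      ⟨⟨_, hattain⟩, by rintro _ ⟨x, rfl⟩; exact hbound x⟩
    rw [optimalRevenue, hgreat.csSup_eq]
    exact hgreat
  have hinj : Function.Injective (markupPrice part c) :=
    markupPrice_injective fun n => ⟨i₀ n, hi₀ n⟩
  refine ⟨hR, fun z' => ?_, hG', z, isMaxOn_univ_iff_eq hRz hRlt,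
    isMaxOn_univ_iff_eq ((hρR z).trans hRz) fun z' hz' => ?_, hWiff,
    bijOn_purchaseProb hGn r hne hcomp hh, strictConcaveOn_reducedRevenueOfProb hGn r hne hcomp hh,
    fun p hp => ?_, fun n t => convexOn_blockG (hGn n) (hconv n) t,
    fun n => ⟨continuous_minBlockG (hGn n) (hcomp n),
      strictAnti_minBlockG (hGn n) (r n) (hcomp n) (hne n) (hh n)⟩,
    ⟨glue e, hmem, fun n => ?_, fun ab hab x _ => (hle x).trans (hge ab hab)⟩, hopt,
    lam, ⟨⟨_, hRz⟩, ?_⟩, ⟨⟨glue e, hmem, ?_⟩, ?_⟩⟩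
  · rw [hρR, ← hmarkup]
    exact hR _
  · rw [hρR]
    exact hRlt _ fun h => hz' (hinj h)
  · obtain ⟨y, rfl⟩ := exists_purchaseProb_eq (c := c) hGn r hne hcomp hh hp
    rw [(injective_purchaseProb hGn r hne hcomp hh).eq_iff, ← hWiff, isMaxOn_iff, isMaxOn_iff,
      ← (bijOn_purchaseProb (c := c) hGn r hne hcomp hh).image_eq, Set.forall_mem_image]
    simp only [reducedRevenueOfProb_purchaseProb hGn r hne hcomp hh]
  · rw [hres]
    exact hmin n
  · rintro _ ⟨x, rfl⟩
    exact hRle x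
  · obtain ⟨x, hx⟩ := (hopt _ hmem).1
    exact le_antisymm (hx ▸ hle x) (hval ▸ (hopt _ hmem).2 ⟨_, rfl⟩)
  · rintro _ ⟨ab, hab, rfl⟩
    exact (hge ab hab).trans ((hopt ab hab).2 ⟨_, rfl⟩)
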